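/- **Syntax.** Formulae of modal dependence logic $\mathrm{MDL}$ over a set $AP$ of atomic propositions are given by $$\varphi ::= \top \mid \bot \mid q \mid \neg q \mid \varphi\vee\varphi \mid \varphi\veebar\varphi \mid \varphi\wedge\varphi \mid \mathsf{AX}\,\varphi \mid \mathsf{EX}\,\varphi \mid \mathrm{dep}(p_1,\dots,p_n;q) \mid \neg\,\mathrm{dep}(p_1,\dots,p_n;q)$$ with $n\ge 0$ and $p_1,\dots,p_n,q\in AP$. The arity of $\mathrm{dep}(p_1,\dots,p_n;q)$ is $n$. For a set $M$ of operators and $k\ge 0$, $\mathrm{MDL}_k[M]$ is the set of formulae built from atomic propositions using only operators from $M$ in which every (possibly negated) dependence atom has arity at most $k$. **Semantics.** A Kripke structure $W=(S,R,\pi)$ consists of a non-empty set $S$ of worlds, a relation $R\subseteq S\times S$ and a labelling $\pi:S\to\mathcal P(AP)$. For a team $T\subseteq S$: - $W,T\models\top$ always; $W,T\models\bot$ iff $T=\emptyset$; - $W,T\models q$ (resp. $\neg q$) iff $q\in\pi(s)$ (resp. $q\notin\pi(s)$) for all $s\in T$; - $W,T\models\mathrm{dep}(p_1,\dots,p_n;q)$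 iff any $s_1,s_2\in T$ with $\pi(s_1)\cap\{p_1,\dots,p_n\}=\pi(s_2)\cap\{p_1,\dots,p_n\}$ satisfy $\pi(s_1)\cap\{q\}=\pi(s_2)\cap\{q\}$; $W,T\models\neg\,\mathrm{dep}(p_1,\dots,p_n;q)$ iff $T=\emptyset$; - $W,T\models\varphi\wedge\psi$ iff $W,T\models\varphi$ and $W,T\models\psi$; - $W,T\models\varphi\veebar\psi$ iff $W,T\models\varphi$ or $W,T\models\psi$; - $W,T\models\varphi\vee\psi$ iff $T=T_1\cup T_2$ for some $T_1,T_2$ with $W,T_1\models\varphi$ and $W,T_2\models\psi$; - $W,T\models\mathsf{AX}\,\varphi$ iff $W,\{s' : (s,s')\in R\text{ for some }s\in T\}\models\varphi$; - $W,T\models\mathsf{EX}\,\varphi$ iff there is $T'\subseteq S$ with $W,T'\models\varphi$ such that every $s\in T$ has some $s'\in T'$ with $(s,s')\in R$. **Problem.** $\mathrm{MDL\text{-}MC}_k[M]$ is the set of words $\langle W,T,\varphi\rangle$ encoding a Kripke structure $W$ with finitely many worlds over a finite set of atomic propositions, a team $T$ of $W$, and a formula $\varphi\in\mathrm{MDL}_k[M]$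 over these atomic propositions such that $W,T\models\varphi$. (In $\langle W,T,\varphi\rangle$ the relation and the labelling are written out as Boolean matrices and the formula in prefix notation.) **Theorem 5.3.** Let $M\subseteq\{\mathsf{AX},\mathsf{EX},\veebar,\neg,\mathrm{dep}\}$. Then $\mathrm{MDL\text{-}MC}_k[M]$ is in $\mathrm{P}$ for every $k\ge 0$. -/

import Mathlib

/-- Formulae of modal dependence logic over the set `AP` of atomic propositions.
Negation occurs only in front of atomic propositions and of dependence atoms. -/
inductive MDL (AP : Type*) where
  | top : MDL AP
  | bot : MDL AP
  /-- an atomic proposition `q` -/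
  | prop (q : AP) : MDL AP
  /-- a negated atomic proposition `¬ q` -/
  | nprop (q : AP) : MDL AP
  /-- dependence (splitting) disjunction `φ ∨ ψ` -/
  | or (φ ψ : MDL AP) : MDL AP
  /-- classical disjunction `φ ⊻ ψ` -/
  | cor (φ ψ : MDL AP) : MDL AP
  | and (φ ψ : MDL AP) : MDL AP
  | box (φ : MDL AP) : MDL AP
  | dia (φ : MDL AP) : MDL AP
  /-- the dependence atom `dep(p₁, …, pₙ, q)`, where `ps = [p₁, …, pₙ]`; its arity is `n` -/
  | dep (ps : List AP) (q : AP) : MDL AP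
  /-- the negated dependence atom `¬ dep(p₁, …, pₙ, q)` -/
  | ndep (ps : List AP) (q : AP) : MDL AP

/-- An `AP`-Kripke structure with set of worlds `S` (non-emptiness of `S` is imposed where
structures are quantified over): an accessibility relation and a labelling of the worlds. -/
structure KripkeStructure (AP S : Type*) where
  R : S → S → Prop
  label : S → Set AP

/-- Team semantics: `W.Sat T φ` is the relation `W, T ⊨ φ`. -/
def KripkeStructure.Sat {AP S : Type*} (W : KripkeStructure AP S) : Set S → MDL AP → Prop
  | _, .top => True
  | T, .bot => T = ∅
  | T, .prop q => ∀ s ∈ T, q ∈ W.label s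
  | T, .nprop q => ∀ s ∈ T, q ∉ W.label s
  | T, .or φ ψ => ∃ T₁ T₂ : Set S, T = T₁ ∪ T₂ ∧ W.Sat T₁ φ ∧ W.Sat T₂ ψ
  | T, .cor φ ψ => W.Sat T φ ∨ W.Sat T ψ
  | T, .and φ ψ => W.Sat T φ ∧ W.Sat T ψ
  | T, .box φ => W.Sat {s' | ∃ s ∈ T, W.R s s'} φ
  | T, .dia φ => ∃ T' : Set S, W.Sat T' φ ∧ ∀ s ∈ T, ∃ s' ∈ T', W.R s s'
  | T, .dep ps q => ∀ s₁ ∈ T, ∀ s₂ ∈ T,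
      W.label s₁ ∩ {p | p ∈ ps} ≠ W.label s₂ ∩ {p | p ∈ ps} ∨
        W.label s₁ ∩ {q} = W.label s₂ ∩ {q}
  | T, .ndep _ _ => T = ∅

/-- The operators by which fragments of modal dependence logic are defined. -/
inductive MDLOp where
  | box | dia | and | or | cor | neg | top | bot | dep

namespace MDL

/-- The set of operators that occur in a formula. -/
def ops {AP : Type*} : MDL AP → Set MDLOp
  | top => {MDLOp.top}
  | bot => {MDLOp.bot}
  | prop _ => ∅
  | nprop _ => {MDLOp.neg}
  | or φ ψ => {MDLOp.or} ∪ φ.ops ∪ ψ.ops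
  | cor φ ψ => {MDLOp.cor} ∪ φ.ops ∪ ψ.ops
  | and φ ψ => {MDLOp.and} ∪ φ.ops ∪ ψ.ops
  | box φ => {MDLOp.box} ∪ φ.ops
  | dia φ => {MDLOp.dia} ∪ φ.ops
  | dep _ _ => {MDLOp.dep}
  | ndep _ _ => {MDLOp.neg, MDLOp.dep}

/-- No dependence atom in the formula (negated or not) has arity greater than `k`. -/
def ArityLE {AP : Type*} (k : ℕ) : MDL AP → Prop
  | top => True
  | bot => True
  | prop _ => True
  | nprop _ => True
  | or φ ψ => φ.ArityLE k ∧ ψ.ArityLE k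
  | cor φ ψ => φ.ArityLE k ∧ ψ.ArityLE k
  | and φ ψ => φ.ArityLE k ∧ ψ.ArityLE k
  | box φ => φ.ArityLE k
  | dia φ => φ.ArityLE k
  | dep ps _ => ps.length ≤ k
  | ndep ps _ => ps.length ≤ k

/-- The fragment `MDL_k[M]`: formulae built from atomic propositions with operators from `M`
only, with dependence atoms of arity at most `k`. -/
def fragment (AP : Type*) (k : ℕ) (M : Set MDLOp) : Set (MDL AP) :=
  {φ | φ.ops ⊆ M ∧ φ.ArityLE k}

end MDL

/-- An instance `(W, T, φ)` of the model checking problem: a finite non-empty set of worlds,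
a finite set of atomic propositions, a Kripke structure `W` on them, a team `T` and a formula. -/
structure MCInstance where
  numWorlds : ℕ
  numProps : ℕ
  numWorlds_pos : 0 < numWorlds
  W : KripkeStructure (Fin numProps) (Fin numWorlds)
  T : Set (Fin numWorlds)
  φ : MDL (Fin numProps)

/-- The finite alphabet in which instances are written. -/
inductive MCSymbol where
  | zero | one | prop | neg | top | bot | and | or | cor | box | dia | dep | semicolon
  deriving DecidableEq

instance : Fintype MCSymbol where
  elems := {.zero, .one, .prop, .neg, .top, .bot, .and, .or, .cor, .box, .dia, .dep, .semicolon}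
  complete x := by cases x <;> decide

namespace MCSymbol

/-- The unary numeral `1 … 1 0` with `n` ones. -/
def unary (n : ℕ) : List MCSymbol := List.replicate n one ++ [zero]

open Classical in
/-- The truth value of a proposition as a bit. -/
noncomputable def bit (p : Prop) : MCSymbol := if p then one else zero

/-- An atomic proposition, written by its index. -/
def encodeProp {m : ℕ} (p : Fin m) : List MCSymbol := prop :: unary p

/-- A formula, written in prefix (Polish) notation. -/
def encodeFormula {m : ℕ} : MDL (Fin m) → List MCSymbol
  | .top => [top]
  | .bot => [bot]
  | .prop q => encodeProp q
  | .nprop q => neg :: encodeProp q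
  | .or φ ψ => or :: (encodeFormula φ ++ encodeFormula ψ)
  | .cor φ ψ => cor :: (encodeFormula φ ++ encodeFormula ψ)
  | .and φ ψ => and :: (encodeFormula φ ++ encodeFormula ψ)
  | .box φ => box :: encodeFormula φ
  | .dia φ => dia :: encodeFormula φ
  | .dep ps q => dep :: (ps.flatMap encodeProp ++ semicolon :: encodeProp q)
  | .ndep ps q => neg :: dep :: (ps.flatMap encodeProp ++ semicolon :: encodeProp q)

end MCSymbol

open MCSymbol in
/-- The word `⟨W, T, φ⟩`: the numbers of worlds and of propositions, the characteristic vector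
of the team, the adjacency matrix and the labelling matrix (both row by row, with one row for
each world), and the formula. As the two matrices are written out, unary and binary numerals
give words of polynomially related length. -/
noncomputable def MCInstance.encode (I : MCInstance) : List MCSymbol :=
  unary I.numWorlds ++ unary I.numProps ++
    (List.finRange I.numWorlds).map (fun s => bit (s ∈ I.T)) ++
    (List.finRange I.numWorlds).flatMap (fun s =>
      (List.finRange I.numWorlds).map (fun t => bit (I.W.R s t))) ++
    (List.finRange I.numWorlds).flatMap (fun s =>
      (List.finRange I.numProps).map (fun p => bit (p ∈ I.W.label s))) ++
    encodeFormula I.φ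

/-- The model checking problem for `MDL_k[M]`, as a set of words. -/
def modelChecking (k : ℕ) (M : Set MDLOp) : Language MCSymbol :=
  {w | ∃ I : MCInstance,
    I.φ ∈ MDL.fragment (Fin I.numProps) k M ∧ I.W.Sat I.T I.φ ∧ I.encode = w}

open Classical in
/-- The language `L` is in the class P: a deterministic Turing machine (with finitely many
states and stacks) answers, on every word `w` over the alphabet, whether `w ∈ L`, within a
number of steps that is bounded by a polynomial in the length of `w`. -/
def InP {Γ : Type} (L : Language Γ) : Prop :=
  Nonempty (Turing.TM2ComputableInPolyTime (id : List Γ → List Γ) Computability.encodeBool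
    (fun w => decide (w ∈ L)))

/-! Without `∧` and `∨`, a formula is a tree in which only `⊻` branches. Both modalities commute
with `⊻` (`MCTable.pathSat_or`), so the formula is equivalent to the classical disjunction of its
atoms, each preceded by the modalities on its branch. There are at most as many disjuncts as symbols
in the formula.

A dependence atom of arity at most `k` is itself a classical disjunction: on the team, `q` is a
function of the `pᵢ`, so for one of the functions `f : Bits k → Bool` every world satisfies `q =
f(p₁, …, pₙ)` (`ModelChecker.sat_dep`). The number of these functions depends on `k` only. Every
alternative is flat, that is, it holds in a team iff the team is contained in a fixed set `X` of
worlds. Modalities preserve flatness and act on `X` as the usual box and diamond of modal logic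
(`MCTable.pathSat_forall`). What remains is to evaluate chains of modalities on sets of worlds and
to compare the results with the team.

This is done in one pass over the prefix notation (`ModelChecker.scan`). The stack `path` holds the
operators in whose scope the current position lies, innermost on top: `some true` for `AX`, `some
false` for `EX`, and `none` for a `⊻` whose second disjunct is still unread. After an atom, the
operators down to the nearest `none` are dropped, and the second disjunct is read under what is
left. A Boolean remembers whether some disjunct was satisfied. `ModelChecker.scan_encodeFormula`
says that this is correct on words of formulae, and `ModelChecker.exists_formula_of_scan` that other
words are rejected.

For the time bound the algorithm is written as a `StackProg`, whose semantics `Run` counts steps.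
`Run.reach` compiles such programs to multi-stack Turing machines, and `inP_of_run` concludes
membership in P. Each item of the input costs at most a constant times the third power of the input
length. -/

/-! ### Stack programs and their compilation to Turing machines -/

/-- Programs that operate on stacks: the stack `k : K` has alphabet `Γ k`. `pop k body` pops the
stack `k` and continues according to the symbol, `loop k again body` repeats this as long as
`again` holds for the symbol popped, and `fail` aborts the program. -/
inductive StackProg {K : Type} (Γ : K → Type) : Type
  | skip : StackProg Γ
  | fail : StackProg Γ
  | push (k : K) (a : Γ k) : StackProg Γ
  | pop (k : K) (body : Option (Γ k) → StackProg Γ) : StackProg Γ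
  | seq (p q : StackProg Γ) : StackProg Γ
  | loop (k : K) (again : Option (Γ k) → Bool) (body : Option (Γ k) → StackProg Γ) : StackProg Γ

/-- A type of states that hold a stack over `Γ k` for each `k : K`. -/
class StackStore {K : Type} [DecidableEq K] (Γ : outParam (K → Type)) (St : Type) where
  get : St → ∀ k, List (Γ k)
  set : St → ∀ k, List (Γ k) → St
  get_set : ∀ S k l, get (set S k l) = Function.update (get S) k l
  get_inj : ∀ S S', get S = get S' → S = S'

namespace StackProg

open StackStore Turing

infixr:60 " ;; " => StackProg.seq

variable {K : Type} {Γ : K → Type}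

/-- The control locations of a program. -/
def Lbl : StackProg Γ → Type
  | skip => Unit
  | fail => Unit
  | push _ _ => Unit
  | pop k body => Option (Σ x : Option (Γ k), (body x).Lbl)
  | seq p q => p.Lbl ⊕ q.Lbl
  | loop k _ body => Option (Σ x : Option (Γ k), (body x).Lbl)

/-- The location at which a program starts. -/
def entry : (p : StackProg Γ) → p.Lbl
  | skip => ()
  | fail => ()
  | push _ _ => ()
  | pop _ _ => none
  | seq p _ => Sum.inl p.entry
  | loop _ _ _ => none

theorem finite_lbl [∀ k, Finite (Γ k)] (p : StackProg Γ) : Finite p.Lbl := by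
  induction p with
  | skip => exact inferInstanceAs (Finite Unit)
  | fail => exact inferInstanceAs (Finite Unit)
  | push => exact inferInstanceAs (Finite Unit)
  | pop k body ih => exact inferInstanceAs (Finite (Option (Σ x : Option (Γ k), (body x).Lbl)))
  | seq p q hp hq => exact inferInstanceAs (Finite (p.Lbl ⊕ q.Lbl))
  | loop k _ body ih =>
    exact inferInstanceAs (Finite (Option (Σ x : Option (Γ k), (body x).Lbl)))

variable [DecidableEq K] {St : Type} [StackStore Γ St]

/-- `Run p S o t`: started in the state `S`, the program `p` takes at most `t` steps and ends
normally in the state `S'` if `o = some S'`, and by `fail` if `o = none`. -/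
inductive Run : StackProg Γ → St → Option St → ℕ → Prop
  | skip (S : St) : Run skip S (some S) 1
  | fail (S : St) : Run fail S none 1
  | push (k : K) (a : Γ k) (S : St) : Run (push k a) S (some (set S k (a :: get S k))) 1
  | pop {k : K} {body : Option (Γ k) → StackProg Γ} {S : St} {o : Option St} {t : ℕ} :
      Run (body (get S k).head?) (set S k (get S k).tail) o t → Run (pop k body) S o (t + 1)
  | seq {p q : StackProg Γ} {S S' : St} {o : Option St} {t t' : ℕ} :
      Run p S (some S') t → Run q S' o t' → Run (p ;; q) S o (t + t')
  | seq_fail {p q : StackProg Γ} {S : St} {t : ℕ} : Run p S none t → Run (p ;; q) S none t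
  | loop_exit {k : K} {again : Option (Γ k) → Bool} {body : Option (Γ k) → StackProg Γ} {S : St}
      {o : Option St} {t : ℕ} : again (get S k).head? = false →
      Run (body (get S k).head?) (set S k (get S k).tail) o t →
      Run (loop k again body) S o (t + 1)
  | loop_fail {k : K} {again : Option (Γ k) → Bool} {body : Option (Γ k) → StackProg Γ} {S : St}
      {t : ℕ} : again (get S k).head? = true →
      Run (body (get S k).head?) (set S k (get S k).tail) none t →
      Run (loop k again body) S none (t + 1)
  | loop_next {k : K} {again : Option (Γ k) → Bool} {body : Option (Γ k) → StackProg Γ}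
      {S S' : St} {o : Option St} {t t' : ℕ} : again (get S k).head? = true →
      Run (body (get S k).head?) (set S k (get S k).tail) (some S') t →
      Run (loop k again body) S' o t' →
      Run (loop k again body) S o (t + t' + 1)
  | mono {p : StackProg Γ} {S : St} {o : Option St} {t t' : ℕ} :
      Run p S o t → t ≤ t' → Run p S o t'

/-- The statements of a Turing machine that executes the program: the locations are embedded in
the labels of the machine by `emb`, and the machine leaves the program at the label `ok` or, after
a failure, at the label `rej`. -/
def code {Λ : Type} : (p : StackProg Γ) → (p.Lbl → Λ) → Λ → Λ → p.Lbl →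
    TM2.Stmt Γ Λ (∀ k, Option (Γ k))
  | skip, _, ok, _, _ => .goto fun _ => ok
  | fail, _, _, rej, _ => .goto fun _ => rej
  | push k a, _, ok, _, _ => .push k (fun _ => a) (.goto fun _ => ok)
  | pop k body, emb, _, _, none => .pop k (fun v x => Function.update v k x)
      (.goto fun v => emb (some ⟨v k, (body (v k)).entry⟩))
  | pop _ body, emb, ok, rej, some ⟨x, l⟩ =>
      (body x).code (fun l => emb (some ⟨x, l⟩)) ok rej l
  | seq p q, emb, _, rej, Sum.inl l =>
      p.code (fun l => emb (Sum.inl l)) (emb (Sum.inr q.entry)) rej l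
  | seq _ q, emb, ok, rej, Sum.inr l => q.code (fun l => emb (Sum.inr l)) ok rej l
  | loop k _ body, emb, _, _, none => .pop k (fun v x => Function.update v k x)
      (.goto fun v => emb (some ⟨v k, (body (v k)).entry⟩))
  | loop _ again body, emb, ok, rej, some ⟨x, l⟩ =>
      (body x).code (fun l => emb (some ⟨x, l⟩)) (if again x then emb none else ok) rej l

/-- The machine `m` gets from the first configuration to the second one in at most `t` steps, in
which no stack grows by more than `t`. -/
def Reach {Λ σ : Type} (m : Λ → TM2.Stmt Γ Λ σ) (t : ℕ) (c c' : TM2.Cfg Γ Λ σ) : Prop :=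
  (∃ n ≤ t, (flip bind (TM2.step m))^[n] (some c) = some c') ∧
    ∀ k, (c'.stk k).length ≤ (c.stk k).length + t

theorem Reach.trans {Λ σ : Type} {m : Λ → TM2.Stmt Γ Λ σ} {t t' : ℕ} {c c' c'' : TM2.Cfg Γ Λ σ}
    (h : Reach m t c c') (h' : Reach m t' c' c'') : Reach m (t + t') c c'' := by
  obtain ⟨⟨n, hn, e⟩, hk⟩ := h
  obtain ⟨⟨n', hn', e'⟩, hk'⟩ := h'
  refine ⟨⟨n' + n, by omega, by rw [Function.iterate_add_apply, e, e']⟩, fun k => ?_⟩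
  have := hk k
  have := hk' k
  omega

theorem Reach.mono {Λ σ : Type} {m : Λ → TM2.Stmt Γ Λ σ} {t t' : ℕ} {c c' : TM2.Cfg Γ Λ σ}
    (h : Reach m t c c') (ht : t ≤ t') : Reach m t' c c' :=
  ⟨h.1.imp fun _ hn => ⟨hn.1.trans ht, hn.2⟩, fun k => (h.2 k).trans (by omega)⟩

theorem Reach.single {Λ σ : Type} {m : Λ → TM2.Stmt Γ Λ σ} {c c' : TM2.Cfg Γ Λ σ}
    (h : TM2.step m c = some c') (hk : ∀ k, (c'.stk k).length ≤ (c.stk k).length + 1) :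
    Reach m 1 c c' :=
  ⟨⟨1, le_rfl, h⟩, hk⟩

theorem reach_pop {Λ : Type} {m : Λ → TM2.Stmt Γ Λ (∀ k, Option (Γ k))} {l : Λ} {k : K}
    {f : Option (Γ k) → Λ}
    (h : m l = .pop k (fun v x => Function.update v k x) (.goto fun v => f (v k)))
    (v : ∀ k, Option (Γ k)) (S : St) :
    Reach m 1 ⟨some l, v, get S⟩ ⟨some (f (get S k).head?), Function.update v k (get S k).head?,
      get (set S k (get S k).tail)⟩ := by
  refine Reach.single ?_ fun k' => ?_
  · simp [h, get_set]
  · dsimp only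
    rw [get_set]
    rcases eq_or_ne k' k with rfl | hk
    · simp
      omega
    · simp [hk]

/-- A machine that contains the code of a program executes it. -/
theorem Run.reach {p : StackProg Γ} {S : St} {o : Option St} {t : ℕ} (h : Run p S o t) :
    ∀ {Λ : Type} (m : Λ → TM2.Stmt Γ Λ (∀ k, Option (Γ k))) (emb : p.Lbl → Λ) (ok rej : Λ)
      (_ : ∀ l, m (emb l) = p.code emb ok rej l) (v : ∀ k, Option (Γ k)),
      ∃ v' F, Reach m t ⟨some (emb p.entry), v, get S⟩
        ⟨some (if o.isSome then ok else rej), v', F⟩ ∧ ∀ S', o = some S' → F = get S' := by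
  -- Arbitrary `m` and `emb` are needed because a subprogram runs inside the machine of the whole
  -- program, with its own embedding and exit labels. After a failure the contents `F` are
  -- unspecified, but `Reach` still bounds their heights, which is all that the final clearing
  -- needs.
  induction h with
  | skip S =>
    intro Λ m emb ok rej hm v
    exact ⟨v, get S, Reach.single (by simp [hm, code]) (by simp), by rintro _ ⟨⟩; rfl⟩
  | fail S =>
    intro Λ m emb ok rej hm v
    exact ⟨v, get S, Reach.single (by simp [hm, code]) (by simp), by rintro _ ⟨⟩⟩
  | push k a S =>
    intro Λ m emb ok rej hm v
    refine ⟨v, _, Reach.single (by simp [hm, code]; rfl) fun k' => ?_, ?_⟩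
    · rcases eq_or_ne k' k with rfl | hk
      · simp
      · simp [hk]
    · rintro _ ⟨⟩
      rw [get_set]
  | @pop k body S o t _ ih =>
    intro Λ m emb ok rej hm v
    obtain ⟨v', F, hr, hF⟩ := ih m (fun l => emb (some ⟨_, l⟩)) ok rej (fun l => hm (some ⟨_, l⟩))
      (Function.update v k (get S k).head?)
    exact ⟨v', F, ((reach_pop (f := fun x => emb (some ⟨x, (body x).entry⟩))
      (hm none) v S).trans hr).mono (by omega), hF⟩
  | @seq p q S S' o t t' _ _ ih ih' =>
    intro Λ m emb ok rej hm v
    obtain ⟨v₁, F₁, hr, hF⟩ := ih m (fun l => emb (Sum.inl l)) (emb (Sum.inr q.entry)) rej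
      (fun l => hm (Sum.inl l)) v
    obtain rfl := hF _ rfl
    obtain ⟨v₂, F₂, hr', hF'⟩ := ih' m (fun l => emb (Sum.inr l)) ok rej
      (fun l => hm (Sum.inr l)) v₁
    exact ⟨v₂, F₂, hr.trans hr', hF'⟩
  | @seq_fail p q S t _ ih =>
    intro Λ m emb ok rej hm v
    obtain ⟨v₁, F₁, hr, hF⟩ := ih m (fun l => emb (Sum.inl l)) (emb (Sum.inr q.entry)) rej
      (fun l => hm (Sum.inl l)) v
    exact ⟨v₁, F₁, hr, hF⟩
  | @loop_exit k again body S o t ha _ ih =>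
    intro Λ m emb ok rej hm v
    obtain ⟨v', F, hr, hF⟩ := ih m (fun l => emb (some ⟨_, l⟩)) ok rej
      (fun l => (hm (some ⟨_, l⟩)).trans (by simp [code, ha]))
      (Function.update v k (get S k).head?)
    exact ⟨v', F, ((reach_pop (f := fun x => emb (some ⟨x, (body x).entry⟩))
      (hm none) v S).trans hr).mono (by omega), hF⟩
  | @loop_fail k again body S t ha _ ih =>
    intro Λ m emb ok rej hm v
    obtain ⟨v', F, hr, hF⟩ := ih m (fun l => emb (some ⟨_, l⟩)) (emb none) rej
      (fun l => (hm (some ⟨_, l⟩)).trans (by simp [code, ha]))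
      (Function.update v k (get S k).head?)
    exact ⟨v', F, ((reach_pop (f := fun x => emb (some ⟨x, (body x).entry⟩))
      (hm none) v S).trans hr).mono (by omega), hF⟩
  | @loop_next k again body S S' o t t' ha _ _ ih ih' =>
    intro Λ m emb ok rej hm v
    obtain ⟨v₁, F₁, hr, hF⟩ := ih m (fun l => emb (some ⟨_, l⟩)) (emb none) rej
      (fun l => (hm (some ⟨_, l⟩)).trans (by simp [code, ha]))
      (Function.update v k (get S k).head?)
    obtain rfl := hF _ rfl
    obtain ⟨v₂, F₂, hr', hF'⟩ := ih' m emb ok rej hm v₁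
    exact ⟨v₂, F₂, (((reach_pop (f := fun x => emb (some ⟨x, (body x).entry⟩))
      (hm none) v S).trans hr).trans hr').mono (by omega), hF'⟩
  | mono _ ht ih =>
    intro Λ m emb ok rej hm v
    obtain ⟨v', F, hr, hF⟩ := ih m emb ok rej hm v
    exact ⟨v', F, hr.mono ht, hF⟩

/-- Pop each of the stacks `ks` and then execute `q`. -/
def popAll {Λ : Type} (ks : List K) (q : TM2.Stmt Γ Λ (∀ k, Option (Γ k))) :
    TM2.Stmt Γ Λ (∀ k, Option (Γ k)) :=
  ks.foldr (fun k q => .pop k (fun v x => Function.update v k x) q) q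

/-- A single machine step may pop every stack. Distinctness of the stacks matters: a second pop of
the same stack would overwrite the symbol remembered for it. -/
theorem stepAux_popAll {Λ : Type} (q : TM2.Stmt Γ Λ (∀ k, Option (Γ k))) (ks : List K)
    (hks : ks.Nodup) (v : ∀ k, Option (Γ k)) (F : ∀ k, List (Γ k)) :
    TM2.stepAux (popAll ks q) v F = TM2.stepAux q
      (fun k => if k ∈ ks then (F k).head? else v k)
      (fun k => if k ∈ ks then (F k).tail else F k) := by
  induction ks generalizing v F with
  | nil => simp [popAll]
  | cons k ks ih =>
    obtain ⟨hk, hks⟩ := List.nodup_cons.1 hks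
    refine (ih hks _ _).trans ?_
    congr 1 <;> funext k' <;> rcases eq_or_ne k' k with rfl | hne <;> simp [*]

open Classical in
/-- The code of a Turing machine that executes the program `p`, and finally clears all stacks and
writes the verdict on the stack `out`. -/
noncomputable def machineCode [Fintype K] (p : StackProg Γ) (out : K) (enc : Bool → Γ out) :
    p.Lbl ⊕ Bool → TM2.Stmt Γ (p.Lbl ⊕ Bool) (∀ k, Option (Γ k))
  | Sum.inl l => p.code Sum.inl (Sum.inr true) (Sum.inr false) l
  | Sum.inr b => popAll Finset.univ.toList
      (.branch (fun v => decide (v = fun _ => none)) (.push out (fun _ => enc b) .halt)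
        (.goto fun _ => Sum.inr b))

/-- A Turing machine that executes the program `p` with its input on the stack `inp`, and finally
clears all stacks and writes the verdict on the stack `out`. -/
noncomputable def machine [Fintype K] [∀ k, Finite (Γ k)] (p : StackProg Γ) (inp out : K)
    (enc : Bool → Γ out) : FinTM2 :=
  letI := fun k => Fintype.ofFinite (Γ k)
  haveI := p.finite_lbl
  { K := K
    k₀ := inp
    k₁ := out
    Γ := Γ
    Λ := p.Lbl ⊕ Bool
    ΛFin := Fintype.ofFinite _
    main := Sum.inl p.entry
    σ := ∀ k, Option (Γ k)
    σFin := Fintype.ofFinite _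
    initialState := fun _ => none
    m := p.machineCode out enc }

/-- Each round removes one symbol from every stack, so `t` rounds empty stacks of height at most
`t`. One more round finds all of them empty; then the internal memory is `none` everywhere, which is
also the initial state demanded of a halting configuration. -/
theorem reach_clear [Fintype K] (p : StackProg Γ) (out : K)
    (enc : Bool → Γ out) (b : Bool) (t : ℕ) (v : ∀ k, Option (Γ k)) (F : ∀ k, List (Γ k))
    (hF : ∀ k, (F k).length ≤ t) :
    ∃ n ≤ t + 1, (flip bind (TM2.step (p.machineCode out enc)))^[n]
      (some ⟨some (Sum.inr b), v, F⟩) = some ⟨none, fun _ => none,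
        Function.update (fun _ => []) out [enc b]⟩ := by
  induction t generalizing v F with
  | zero =>
    have hF' : F = fun _ => [] := funext fun k => List.length_eq_zero_iff.1 (by simpa using hF k)
    refine ⟨1, le_rfl, ?_⟩
    simp [flip, machineCode, stepAux_popAll, Finset.nodup_toList, hF']
  | succ t ih =>
    by_cases hF' : F = fun _ => []
    · refine ⟨1, by omega, ?_⟩
      simp [flip, machineCode, stepAux_popAll, Finset.nodup_toList, hF']
    · obtain ⟨n, hn, e⟩ := ih (fun k => (F k).head?) (fun k => (F k).tail)
        (fun k => by have := hF k; simp; omega)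
      refine ⟨n + 1, by omega, ?_⟩
      rw [Function.iterate_succ_apply, ← e]
      congr 1
      have : ¬ ((fun k => (F k).head?) = fun _ => none) := fun h => hF' (funext fun k => by
        simpa using congrFun h k)
      simp [flip, machineCode, stepAux_popAll, Finset.nodup_toList, this]

end StackProg

theorem Turing.initList_eq (tm : Turing.FinTM2) (s : List (tm.Γ tm.k₀)) :
    Turing.initList tm s = (⟨some tm.main, tm.initialState, Function.update (fun _ => []) tm.k₀ s⟩ :
      Turing.TM2.Cfg tm.Γ tm.Λ tm.σ) := by
  refine congrArg (Turing.TM2.Cfg.mk (some tm.main) tm.initialState) (funext fun k => ?_)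
  by_cases hk : k = tm.k₀
  · subst hk
    simp
  · simp [hk]

theorem Turing.haltList_eq (tm : Turing.FinTM2) (s : List (tm.Γ tm.k₁)) :
    Turing.haltList tm s = (⟨none, tm.initialState, Function.update (fun _ => []) tm.k₁ s⟩ :
      Turing.TM2.Cfg tm.Γ tm.Λ tm.σ) := by
  refine congrArg (Turing.TM2.Cfg.mk none tm.initialState) (funext fun k => ?_)
  by_cases hk : k = tm.k₁
  · subst hk
    simp
  · simp [hk]

open StackProg in
/-- A language is in P if a stack program recognizes it in polynomial time. -/
theorem inP_of_run {A K : Type} [DecidableEq K] [Fintype K] {Γ : K → Type} [∀ k, Finite (Γ k)]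
    {St : Type} [StackStore Γ St] (L : Language A) (p : StackProg Γ) (inp out : K)
    (ei : Γ inp ≃ A) (eo : Γ out ≃ Bool) (init : List A → St)
    (h_init : ∀ w, StackStore.get (init w) =
      Function.update (fun _ => []) inp (w.map ei.symm))
    (time : Polynomial ℕ)
    (h : ∀ w, ∃ o : Option St, Run p (init w) o (time.eval w.length) ∧ (o.isSome ↔ w ∈ L)) :
    InP L := by
  classical
  refine ⟨{
    tm := p.machine inp out eo.symm
    inputAlphabet := ei
    outputAlphabet := eo
    -- The program runs for `time` steps, during which stacks reach height at most `X + time`;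
    -- clearing them takes one step more than that height.
    time := 2 * time + Polynomial.X + 1
    outputsFun := fun w => ?_ }⟩
  apply Classical.choice
  obtain ⟨o, hr, ho⟩ := h w
  obtain ⟨v, F, ⟨⟨n, hn, e⟩, hk⟩, -⟩ := hr.reach (p.machineCode out eo.symm) Sum.inl
    (Sum.inr true) (Sum.inr false) (fun _ => rfl) (fun _ => none)
  obtain ⟨n', hn', e'⟩ := reach_clear p out eo.symm o.isSome (w.length + time.eval w.length)
    v F (fun k => (hk k).trans (by
      dsimp only
      rw [h_init]
      rcases eq_or_ne k inp with rfl | hk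
      · simp
      · simp [hk]))
  have hb : decide (w ∈ L) = o.isSome := by
    rw [Bool.eq_iff_iff]
    simp [ho]
  have h0 : Turing.initList (p.machine inp out eo.symm) (List.map ei.invFun (id w)) =
      (⟨some (Sum.inl p.entry), fun _ => none, StackStore.get (init w)⟩ :
        Turing.TM2.Cfg Γ (p.Lbl ⊕ Bool) (∀ k, Option (Γ k))) := by
    rw [h_init]
    exact Turing.initList_eq _ _
  have h1 : Turing.haltList (p.machine inp out eo.symm)
      (List.map eo.invFun (Computability.encodeBool (decide (w ∈ L)))) =
      (⟨none, fun _ => none, Function.update (fun _ => []) out [eo.symm o.isSome]⟩ :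
        Turing.TM2.Cfg Γ (p.Lbl ⊕ Bool) (∀ k, Option (Γ k))) := by
    rw [hb]
    exact Turing.haltList_eq _ _
  refine ⟨⟨⟨n' + n, ?_⟩, ?_⟩⟩
  · rw [Function.iterate_add_apply, h0, Option.map_some, h1]
    refine Eq.trans ?_ e'
    refine congrArg _ (e.trans ?_)
    cases o <;> rfl
  · simp
    omega

/-! ### Derived rules for running stack programs -/

namespace StackStore

variable {K : Type} [DecidableEq K] {Γ : K → Type} {St : Type} [StackStore Γ St]

@[simp] theorem get_set_self (S : St) (k : K) (l : List (Γ k)) : get (set S k l) k = l := by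
  simp [get_set]

theorem get_set_ne (S : St) {k k' : K} (h : k' ≠ k) (l : List (Γ k)) :
    get (set S k l) k' = get S k' := by
  simp [get_set, h]

theorem ext {S S' : St} (h : ∀ k : K, get (Γ := Γ) S k = get S' k) : S = S' :=
  get_inj _ _ (funext h)

end StackStore

namespace StackProg

open StackStore

variable {K : Type} [DecidableEq K] {Γ : K → Type} {St : Type} [StackStore Γ St]

/-- Empty the stack `k` and execute `body` for each symbol. -/
def forEach (k : K) (body : Γ k → StackProg Γ) : StackProg Γ :=
  loop k Option.isSome fun x => x.elim skip body

theorem Run.congr {p : StackProg Γ} {S : St} {o o' : Option St} {t : ℕ} (h : Run p S o t)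
    (ho : o = o') : Run p S o' t :=
  ho ▸ h

theorem Run.congr' {p : StackProg Γ} {S S' : St} {o : Option St} {t : ℕ} (h : Run p S o t)
    (hS : S = S') : Run p S' o t :=
  hS ▸ h

theorem Run.forEach_nil {k : K} {body : Γ k → StackProg Γ} {S : St} (h : get S k = []) :
    Run (forEach k body) S (some (set S k [])) 2 := by
  refine Run.loop_exit (by simp [h]) ?_
  rw [h]
  exact Run.skip _

theorem Run.forEach_cons {k : K} {body : Γ k → StackProg Γ} {S S' : St} {a : Γ k} {l : List (Γ k)}
    {o : Option St} {t t' : ℕ} (h : get S k = a :: l) (h₁ : Run (body a) (set S k l) (some S') t)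
    (h₂ : Run (forEach k body) S' o t') : Run (forEach k body) S o (t + t' + 1) := by
  refine Run.loop_next (by simp [h]) ?_ h₂
  rw [h]
  exact h₁

theorem Run.forEach_fail {k : K} {body : Γ k → StackProg Γ} {S : St} {a : Γ k} {l : List (Γ k)}
    {t : ℕ} (h : get S k = a :: l) (h₁ : Run (body a) (set S k l) none t) :
    Run (forEach k body) S none (t + 1) := by
  refine Run.loop_fail (by simp [h]) ?_
  rw [h]
  exact h₁

theorem Run.pop_nil {k : K} {body : Option (Γ k) → StackProg Γ} {S : St} {o : Option St} {t : ℕ}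
    (h : get S k = []) (h₁ : Run (body none) (set S k []) o t) : Run (.pop k body) S o (t + 1) := by
  refine Run.pop ?_
  rw [h]
  exact h₁

theorem Run.pop_cons {k : K} {body : Option (Γ k) → StackProg Γ} {S : St} {o : Option St} {t : ℕ}
    {a : Γ k} {l : List (Γ k)} (h : get S k = a :: l)
    (h₁ : Run (body (some a)) (set S k l) o t) : Run (.pop k body) S o (t + 1) := by
  refine Run.pop ?_
  rw [h]
  exact h₁

theorem Run.loop_exit_nil {k : K} {again : Option (Γ k) → Bool}
    {body : Option (Γ k) → StackProg Γ} {S : St} {o : Option St} {t : ℕ} (h : get S k = [])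
    (ha : again none = false) (h₁ : Run (body none) (set S k []) o t) :
    Run (loop k again body) S o (t + 1) := by
  refine Run.loop_exit (by simpa [h] using ha) ?_
  rw [h]
  exact h₁

theorem Run.loop_exit_cons {k : K} {again : Option (Γ k) → Bool}
    {body : Option (Γ k) → StackProg Γ} {S : St} {o : Option St} {t : ℕ} {a : Γ k} {l : List (Γ k)}
    (h : get S k = a :: l) (ha : again (some a) = false)
    (h₁ : Run (body (some a)) (set S k l) o t) : Run (loop k again body) S o (t + 1) := by
  refine Run.loop_exit (by simpa [h] using ha) ?_
  rw [h]
  exact h₁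

theorem Run.loop_next_cons {k : K} {again : Option (Γ k) → Bool}
    {body : Option (Γ k) → StackProg Γ} {S S' : St} {o : Option St} {t t' : ℕ} {a : Γ k}
    {l : List (Γ k)} (h : get S k = a :: l) (ha : again (some a) = true)
    (h₁ : Run (body (some a)) (set S k l) (some S') t) (h₂ : Run (loop k again body) S' o t') :
    Run (loop k again body) S o (t + t' + 1) := by
  refine Run.loop_next (by simpa [h] using ha) ?_ h₂
  rw [h]
  exact h₁

/-- Move the symbols of the stack `a` to the stack `b`, one by one. -/
def moveTo (a b : K) (c : Γ a → Γ b) : StackProg Γ :=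
  forEach a fun x => push b (c x)

/-- Each symbol costs a pop and a push; the pop of the empty stack and the `skip` account for the
other two steps. The transfer reverses the order. The equation `hl` leaves the form of the new
content to the caller. -/
theorem Run.moveTo {a b : K} (hab : a ≠ b) {c : Γ a → Γ b} {S : St} {l : List (Γ b)}
    (hl : ((get S a).map c).reverse ++ get S b = l) :
    Run (moveTo a b c) S (some (set (set S a []) b l)) (2 * (get S a).length + 2) := by
  subst hl
  induction h : get S a generalizing S with
  | nil =>
    refine (Run.forEach_nil h).congr (congrArg some (StackStore.ext (Γ := Γ) fun k => ?_))
    rcases eq_or_ne k b with rfl | hk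
    · simp [get_set_ne _ hab.symm]
    · simp [get_set_ne _ hk]
  | cons x xs ih =>
    refine (Run.forEach_cons h (.push b (c x) _)
      (ih (S := set (set S a xs) b (c x :: get (set S a xs) b)) ?_)).mono (by simp; omega) |>.congr ?_
    · simp [get_set_ne _ hab]
    · refine congrArg some (StackStore.ext (Γ := Γ) fun k => ?_)
      rcases eq_or_ne k b with rfl | hk
      · simp [get_set_ne _ hab.symm]
      · rcases eq_or_ne k a with rfl | hk'
        · simp [get_set_ne _ hk]
        · simp [get_set_ne _ hk, get_set_ne _ hk']

theorem Run.clear {a : K} (S : St) : Run (forEach a fun _ => StackProg.skip) S (some (set S a []))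
    (2 * (get S a).length + 2) := by
  induction h : get S a generalizing S with
  | nil => exact Run.forEach_nil h
  | cons x xs ih =>
    refine ((Run.forEach_cons h (Run.skip _) (ih (set S a xs) (by simp))).mono (by simp; omega)).congr ?_
    refine congrArg some (StackStore.ext (Γ := Γ) fun k => ?_)
    rcases eq_or_ne k a with rfl | hk
    · simp
    · simp [get_set_ne _ hk]

end StackProg

/-! ### The stacks of the model checker -/

/-- The names of the stacks: the input, the numbers of worlds and of propositions, the team, the
relation, the labelling, an index of a proposition, a list of data on each world, a set of worlds,
a second set of worlds, a flag, the modalities in whose scope we are, and flags that tell whether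
a formula is expected and whether a satisfied disjunct has been found. The stacks `…2` hold the
part of a stack that has been read while it is scanned. -/
inductive Stk
  | inp | worlds | worlds2 | props | props2 | team | team2 | rel | rel2 | lab | lab2 | idx | idx2
  | val | val2 | vec | vec2 | img | acc | path | path2 | todo | ok
  deriving DecidableEq

instance : Fintype Stk where
  elems := {.inp, .worlds, .worlds2, .props, .props2, .team, .team2, .rel, .rel2, .lab, .lab2,
    .idx, .idx2, .val, .val2, .vec, .vec2, .img, .acc, .path, .path2, .todo, .ok}
  complete s := by cases s <;> decide

/-- The bits that a dependence atom reads at a world. -/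
abbrev Bits (k : ℕ) : Type := {l : List Bool // l.length ≤ k + 1}

instance (k : ℕ) : Finite (Bits k) := (List.finite_length_le Bool (k + 1)).to_subtype

/-- The alphabets of the stacks. -/
abbrev Stk.Alph (k : ℕ) : Stk → Type
  | inp => MCSymbol
  | team | team2 | idx | idx2 | vec | vec2 | img => Bool
  | rel | rel2 | lab | lab2 | path | path2 => Option Bool
  | val | val2 => Bits k
  | worlds | worlds2 | props | props2 | acc | todo | ok => Unit

instance (k : ℕ) (s : Stk) : Finite (s.Alph k) := by
  cases s <;> unfold Stk.Alph <;> infer_instance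

/-- The contents of all stacks. -/
@[ext] structure MCState (k : ℕ) where
  inp : List MCSymbol := []
  worlds : List Unit := []
  worlds2 : List Unit := []
  props : List Unit := []
  props2 : List Unit := []
  team : List Bool := []
  team2 : List Bool := []
  rel : List (Option Bool) := []
  rel2 : List (Option Bool) := []
  lab : List (Option Bool) := []
  lab2 : List (Option Bool) := []
  idx : List Bool := []
  idx2 : List Bool := []
  val : List (Bits k) := []
  val2 : List (Bits k) := []
  vec : List Bool := []
  vec2 : List Bool := []
  img : List Bool := []
  acc : List Unit := []
  path : List (Option Bool) := []
  path2 : List (Option Bool) := []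
  todo : List Unit := []
  ok : List Unit := []

namespace MCState

variable {k : ℕ}

@[simp] def get (S : MCState k) : ∀ s : Stk, List (s.Alph k)
  | .inp => S.inp
  | .worlds => S.worlds
  | .worlds2 => S.worlds2
  | .props => S.props
  | .props2 => S.props2
  | .team => S.team
  | .team2 => S.team2
  | .rel => S.rel
  | .rel2 => S.rel2
  | .lab => S.lab
  | .lab2 => S.lab2
  | .idx => S.idx
  | .idx2 => S.idx2
  | .val => S.val
  | .val2 => S.val2
  | .vec => S.vec
  | .vec2 => S.vec2
  | .img => S.img
  | .acc => S.acc
  | .path => S.path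
  | .path2 => S.path2
  | .todo => S.todo
  | .ok => S.ok

@[simp] def set (S : MCState k) : ∀ s : Stk, List (s.Alph k) → MCState k
  | .inp, l => { S with inp := l }
  | .worlds, l => { S with worlds := l }
  | .worlds2, l => { S with worlds2 := l }
  | .props, l => { S with props := l }
  | .props2, l => { S with props2 := l }
  | .team, l => { S with team := l }
  | .team2, l => { S with team2 := l }
  | .rel, l => { S with rel := l }
  | .rel2, l => { S with rel2 := l }
  | .lab, l => { S with lab := l }
  | .lab2, l => { S with lab2 := l }
  | .idx, l => { S with idx := l }
  | .idx2, l => { S with idx2 := l }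
  | .val, l => { S with val := l }
  | .val2, l => { S with val2 := l }
  | .vec, l => { S with vec := l }
  | .vec2, l => { S with vec2 := l }
  | .img, l => { S with img := l }
  | .acc, l => { S with acc := l }
  | .path, l => { S with path := l }
  | .path2, l => { S with path2 := l }
  | .todo, l => { S with todo := l }
  | .ok, l => { S with ok := l }

theorem get_injective {S S' : MCState k} (h : S.get = S'.get) : S = S' := by
  ext1 <;> first
  | exact congrFun h .inp | exact congrFun h .worlds | exact congrFun h .worlds2
  | exact congrFun h .props | exact congrFun h .props2 | exact congrFun h .team
  | exact congrFun h .team2 | exact congrFun h .rel | exact congrFun h .rel2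
  | exact congrFun h .lab | exact congrFun h .lab2 | exact congrFun h .idx
  | exact congrFun h .idx2 | exact congrFun h .val | exact congrFun h .val2
  | exact congrFun h .vec | exact congrFun h .vec2 | exact congrFun h .img
  | exact congrFun h .acc | exact congrFun h .path | exact congrFun h .path2
  | exact congrFun h .todo | exact congrFun h .ok

instance : StackStore (Stk.Alph k) (MCState k) where
  get := get
  set := set
  get_set S s l := by
    funext s'
    cases s <;> cases s' <;> rfl
  get_inj _ _ := get_injective

@[simp] theorem store_get (S : MCState k) (s : Stk) : StackStore.get S s = S.get s :=
  rfl

@[simp] theorem store_set (S : MCState k) (s : Stk) (l : List (s.Alph k)) :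
    StackStore.set S s l = S.set s l :=
  rfl

end MCState

open StackProg StackStore

/-! ### One modality applied to a set of worlds -/

namespace ModelChecker

variable {k : ℕ}

/-- Programs on the stacks of the model checker. -/
abbrev Prog (k : ℕ) : Type := StackProg (Stk.Alph k)

/-- The content of a stack that serves as a flag. -/
def flag (b : Bool) : List Unit := if b then [()] else []

/-- Set a flag. -/
def setFlag (s : Stk) (a : s.Alph k) : Prog k :=
  .pop s fun _ => .push s a

/-- The effect of a modality (`b` for `AX`, `!b` for `EX`) on a set of worlds, at a world with the
set `r` of successors among `ws`. -/
def modality {ι : Type} (b : Bool) (ws : List ι) (r x : ι → Bool) : Bool :=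
  if ws.any fun t => r t && (x t != b) then !b else b

/-- Read an entry of the accessibility matrix, or the end of a row. -/
def applyStep (b : Bool) : Option Bool → Prog k
  | some r => .pop .vec fun x => x.elim .fail fun x : Bool => .push .vec2 x ;;
      if r && (x != b) then setFlag .acc () else .skip
  | none => moveTo .vec2 .vec id ;;
      .pop .acc fun f => .push .img (if f.isSome then !b else b)

/-- Apply a modality to the set of worlds on the stack `vec`, with the result on `img`. -/
def applyLoop (b : Bool) : Prog k :=
  forEach .rel fun c => .push .rel2 c ;; applyStep b c

/-- Replace the set of worlds on the stack `vec` by its image under a modality. -/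
def applyProg (b : Bool) : Prog k :=
  applyLoop b ;; forEach .vec (fun _ => .skip) ;; moveTo .img .vec id ;; moveTo .rel2 .rel id

/-- Popping before pushing keeps at most one symbol on the stack, so setting a flag is idempotent.
-/
theorem run_setFlag_acc (S : MCState k) (f : Bool) (hf : S.acc = flag f) :
    Run (setFlag .acc () : Prog k) S (some { S with acc := flag true }) 2 := by
  cases f
  · exact Run.pop_nil hf ((Run.push _ _ _).congr rfl)
  · exact Run.pop_cons hf ((Run.push _ _ _).congr rfl)

/-- Like its companions below, this instance of `Run.moveTo` presents the final state as a record
update, with which `simp` can compute. -/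
theorem run_move_vec2 (S : MCState k) : Run (moveTo .vec2 .vec id : Prog k) S
    (some { S with vec2 := [], vec := S.vec2.reverse ++ S.vec }) (2 * S.vec2.length + 2) :=
  Run.moveTo (a := Stk.vec2) (b := Stk.vec) Stk.noConfusion (by rw [List.map_id]; rfl)

theorem run_move_img (S : MCState k) : Run (moveTo .img .vec id : Prog k) S
    (some { S with img := [], vec := S.img.reverse ++ S.vec }) (2 * S.img.length + 2) :=
  Run.moveTo (a := Stk.img) (b := Stk.vec) Stk.noConfusion (by rw [List.map_id]; rfl)

theorem run_move_rel2 (S : MCState k) : Run (moveTo .rel2 .rel id : Prog k) S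
    (some { S with rel2 := [], rel := S.rel2.reverse ++ S.rel }) (2 * S.rel2.length + 2) :=
  Run.moveTo (a := Stk.rel2) (b := Stk.rel) Stk.noConfusion (by rw [List.map_id]; rfl)

theorem run_move_team2 (S : MCState k) : Run (moveTo .team2 .team id : Prog k) S
    (some { S with team2 := [], team := S.team2.reverse ++ S.team }) (2 * S.team2.length + 2) :=
  Run.moveTo (a := Stk.team2) (b := Stk.team) Stk.noConfusion (by rw [List.map_id]; rfl)

theorem run_move_path2 (S : MCState k) : Run (moveTo .path2 .path id : Prog k) S
    (some { S with path2 := [], path := S.path2.reverse ++ S.path }) (2 * S.path2.length + 2) :=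
  Run.moveTo (a := Stk.path2) (b := Stk.path) Stk.noConfusion (by rw [List.map_id]; rfl)

theorem run_move_idx2 (S : MCState k) : Run (moveTo .idx2 .idx id : Prog k) S
    (some { S with idx2 := [], idx := S.idx2.reverse ++ S.idx }) (2 * S.idx2.length + 2) :=
  Run.moveTo (a := Stk.idx2) (b := Stk.idx) Stk.noConfusion (by rw [List.map_id]; rfl)

theorem run_move_val (S : MCState k) : Run (moveTo .val .val2 id : Prog k) S
    (some { S with val := [], val2 := S.val.reverse ++ S.val2 }) (2 * S.val.length + 2) :=
  Run.moveTo (a := Stk.val) (b := Stk.val2) Stk.noConfusion (by rw [List.map_id]; rfl)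

theorem run_move_lab (S : MCState k) : Run (moveTo .lab .lab2 id : Prog k) S
    (some { S with lab := [], lab2 := S.lab.reverse ++ S.lab2 }) (2 * S.lab.length + 2) :=
  Run.moveTo (a := Stk.lab) (b := Stk.lab2) Stk.noConfusion (by rw [List.map_id]; rfl)

theorem run_move_worlds2 (S : MCState k) : Run (moveTo .worlds2 .worlds id : Prog k) S
    (some { S with worlds2 := [], worlds := S.worlds2.reverse ++ S.worlds }) (2 * S.worlds2.length + 2) :=
  Run.moveTo (a := Stk.worlds2) (b := Stk.worlds) Stk.noConfusion (by rw [List.map_id]; rfl)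

theorem run_move_props2 (S : MCState k) : Run (moveTo .props2 .props id : Prog k) S
    (some { S with props2 := [], props := S.props2.reverse ++ S.props }) (2 * S.props2.length + 2) :=
  Run.moveTo (a := Stk.props2) (b := Stk.props) Stk.noConfusion (by rw [List.map_id]; rfl)

/-- The rule works backwards, from a run that starts after the row to one that starts inside it, so
that rows can be chained in front of each other. The list `as` is the part of the set already moved
to `vec2`, and `f` tells whether a successor deciding the modality was met. An entry costs six
steps, and two more for moving its bit back to `vec`. -/
theorem run_apply_row {ι : Type} (b : Bool) (r x : ι → Bool) (S : MCState k)
    {o : Option (MCState k)} {t : ℕ} (ts : List ι) (f : Bool) (as : List Bool)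
    (bs rest : List (Option Bool))
    (h : Run (applyLoop b) { S with
      rel := rest
      rel2 := none :: (ts.map fun t => some (r t)).reverse ++ bs
      vec := as.reverse ++ ts.map x
      vec2 := []
      acc := []
      img := (if f || ts.any (fun t => r t && (x t != b)) then !b else b) :: S.img } o t) :
    Run (applyLoop b) { S with
      rel := (ts.map fun t => some (r t)) ++ none :: rest
      rel2 := bs
      vec := ts.map x
      vec2 := as
      acc := flag f } o (t + 8 * ts.length + 2 * as.length + 6) := by
  induction ts generalizing f as bs with
  | nil =>
    refine (Run.forEach_cons rfl (Run.seq (Run.push _ _ _) (Run.seq (run_move_vec2 _)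
      (Run.pop (Run.push _ _ _)))) (h.congr' ?_)).mono ?_
    · cases f <;> simp [flag]
    · simp
      omega
  | cons s ts ih =>
    refine (Run.forEach_cons rfl (Run.seq (Run.push _ _ _) (Run.pop_cons rfl (Run.seq (Run.push _ _ _)
      (t' := 2) ?_))) (ih (f || (r s && (x s != b))) (x s :: as) (some (r s) :: bs) (h.congr' ?_))).mono ?_
    · dsimp only
      split_ifs with hc
      · refine (run_setFlag_acc _ f rfl).congr ?_
        simp [hc]
      · refine ((Run.skip _).mono (by omega)).congr ?_
        simp [hc]
    · simp [Bool.or_assoc]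
    · simp
      omega

/-- The rows of a matrix, each followed by a separator. -/
def encodeRows {ι κ : Type} (ss : List ι) (ts : List κ) (R : ι → κ → Bool) : List (Option Bool) :=
  ss.flatMap fun s => (ts.map fun t => some (R s t)) ++ [none]

theorem length_encodeRows {ι κ : Type} (ss : List ι) (ts : List κ) (R : ι → κ → Bool) :
    (encodeRows ss ts R).length = ss.length * (ts.length + 1) := by
  simp [encodeRows, List.length_flatMap]

/-- Rows `ss` and columns `ts` are separate lists because the induction consumes rows only. -/
theorem run_applyLoop {ι : Type} (b : Bool) (ts : List ι) (R : ι → ι → Bool) (x : ι → Bool)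
    (S : MCState k) (ss : List ι) (bs : List (Option Bool)) (as : List Bool)
    (hrel : S.rel = encodeRows ss ts R) (hrel2 : S.rel2 = bs) (hvec : S.vec = ts.map x)
    (hvec2 : S.vec2 = []) (hacc : S.acc = []) (himg : S.img = as) :
    Run (applyLoop b) S (some { S with
      rel := []
      rel2 := (encodeRows ss ts R).reverse ++ bs
      img := (ss.map fun s => modality b ts (R s) x).reverse ++ as })
      (ss.length * (8 * ts.length + 6) + 2) := by
  induction ss generalizing S bs as with
  | nil =>
    refine ((Run.forEach_nil (hrel.trans rfl)).congr ?_).mono (by omega)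
    simp [encodeRows, ← hrel2, ← himg]
  | cons s ss ih =>
    have := run_apply_row b (R s) x S ts false [] bs (encodeRows ss ts R)
      ((ih _ _ _ rfl rfl rfl rfl rfl rfl))
    refine ((this.congr' ?_).congr ?_).mono ?_
    · ext1 <;> simp [*, encodeRows, flag]
    · simp [hacc, hvec2, hvec, encodeRows, modality, himg]
    · simp
      ring_nf
      omega

end ModelChecker

/-! ### Chains of modalities on a structure given by matrices -/

/-- A finite Kripke structure with a team, given by Boolean matrices. -/
structure MCTable where
  n : ℕ
  m : ℕ
  team : Fin n → Bool
  rel : Fin n → Fin n → Bool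
  lab : Fin n → Fin m → Bool

namespace MCTable

/-- The worlds, in the order in which data on them are kept on the stacks. -/
def worlds (D : MCTable) : List (Fin D.n) := (List.finRange D.n).reverse

@[simp] theorem length_worlds (D : MCTable) : D.worlds.length = D.n := by
  simp [worlds]

/-- The effect of a list of modalities, innermost first, on a set of worlds. -/
def applyPath (D : MCTable) : List (Option Bool) → (Fin D.n → Bool) → Fin D.n → Bool
  | [], x => x
  | none :: p, x => D.applyPath p x
  | some b :: p, x => D.applyPath p fun s => ModelChecker.modality b D.worlds (D.rel s) x

/-- Whether all worlds of the team satisfy the formula that consists of the modalities `p` applied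
to a formula that holds in the worlds `x`. -/
def check (D : MCTable) (p : List (Option Bool)) (x : Fin D.n → Bool) : Bool :=
  !D.worlds.any fun s => D.team s && !D.applyPath p x s

end MCTable

namespace ModelChecker

variable {k : ℕ}

/-- The stacks used by `applyProg` are in order. -/
def RelReady (D : MCTable) (S : MCState k) : Prop :=
  S.rel = encodeRows D.worlds D.worlds D.rel ∧ S.rel2 = [] ∧ S.vec2 = [] ∧ S.img = [] ∧ S.acc = []

theorem run_applyProg {D : MCTable} (b : Bool) {S : MCState k} (hS : RelReady D S)
    {x : Fin D.n → Bool} (hx : S.vec = D.worlds.map x) :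
    Run (applyProg b) S
      (some { S with vec := D.worlds.map fun s => modality b D.worlds (D.rel s) x })
      (12 * (D.n + 1) ^ 2) := by
  obtain ⟨h1, h2, h3, h4, h5⟩ := hS
  refine (((run_applyLoop b _ _ _ S _ _ _ h1 h2 hx h3 h5 h4).seq
    ((Run.clear _).seq ((run_move_img _).seq (run_move_rel2 _)))).congr ?_).mono ?_
  · simp [h1, h2, h4]
  · simp [hx, length_encodeRows]
    ring_nf
    omega

/-- Apply a modality from the stack `path`. -/
def pathStep : Option Bool → Prog k
  | none => .skip
  | some b => applyProg b

/-- Apply the modalities on the stack `path`. -/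
def pathProg : Prog k :=
  forEach .path (fun c => .push .path2 c ;; pathStep c) ;; moveTo .path2 .path id

theorem run_pathProg {D : MCTable} {S : MCState k} (hS : RelReady D S) (hp2 : S.path2 = [])
    {x : Fin D.n → Bool} (hx : S.vec = D.worlds.map x) :
    Run pathProg S (some { S with vec := D.worlds.map (D.applyPath S.path x) })
      (S.path.length * (12 * (D.n + 1) ^ 2 + 4) + 4) := by
  -- The modality on top of `path` is the innermost one and is applied first. What has been applied
  -- is kept on `path2`, from which the path is restored for later atoms.
  have main : ∀ (p q : List (Option Bool)) (x : Fin D.n → Bool), Run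
      (forEach .path (fun c => .push .path2 c ;; pathStep c) : Prog k)
      { S with path := p, path2 := q, vec := D.worlds.map x }
      (some { S with path := [], path2 := p.reverse ++ q,
                     vec := D.worlds.map (D.applyPath p x) })
      (p.length * (12 * (D.n + 1) ^ 2 + 2) + 2) := by
    intro p
    induction p with
    | nil =>
      intro q x
      refine ((Run.forEach_nil rfl).congr ?_).mono ?_ <;> simp [MCTable.applyPath]
    | cons c p ih =>
      intro q x
      cases c with
      | none =>
        refine ((Run.forEach_cons rfl (Run.seq (t' := 1) (Run.push _ _ _) ?_)
          (ih (none :: q) x)).congr ?_).mono ?_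
        · exact Run.skip _
        · simp [MCTable.applyPath]
        · simp
          ring_nf
          nlinarith
      | some b =>
        refine ((Run.forEach_cons rfl (Run.seq (t' := 12 * (D.n + 1) ^ 2) (Run.push _ _ _) ?_)
          (ih (some b :: q) fun s => modality b D.worlds (D.rel s) x)).congr ?_).mono ?_
        · exact run_applyProg (D := D) b (by exact hS) rfl
        · simp [MCTable.applyPath]
        · simp
          ring_nf
          omega
  refine ((((main S.path [] x).congr' ?_).seq (run_move_path2 _)).congr ?_).mono ?_
  · rw [← hp2, ← hx]
  · simp [hp2]
  · simp
    ring_nf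
    omega

/-! ### Comparison with the team, and lists of alternatives -/

/-- Set the flag `ok` if the team is contained in the set of worlds on the stack `vec`, and empty
that stack. -/
def compareProg : Prog k :=
  forEach .team (fun b : Bool => .push .team2 b ;;
      .pop .vec fun x => if b && x == some false then setFlag .acc () else .skip) ;;
    moveTo .team2 .team id ;;
    .pop .acc fun f => if f.isSome then .skip else setFlag .ok ()

theorem run_setFlag_ok (S : MCState k) (f : Bool) (hf : S.ok = flag f) :
    Run (setFlag .ok () : Prog k) S (some { S with ok := flag true }) 2 := by
  cases f
  · exact Run.pop_nil hf ((Run.push _ _ _).congr rfl)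
  · exact Run.pop_cons hf ((Run.push _ _ _).congr rfl)

/-- The flag `acc` records a world of the team outside the set. The flag `ok` is only ever set and
never cleared, so over successive tests it accumulates their disjunction. -/
theorem run_compareProg {D : MCTable} {S : MCState k} (hT : S.team = D.worlds.map D.team)
    (hT2 : S.team2 = []) (hacc : S.acc = []) {x : Fin D.n → Bool} (hx : S.vec = D.worlds.map x)
    {f : Bool} (hf : S.ok = flag f) :
    Run compareProg S
      (some { S with
        vec := []
        ok := flag (f || !D.worlds.any fun s => D.team s && !x s) }) (8 * D.n + 8) := by
  have main : ∀ (ts : List (Fin D.n)) (as : List Bool) (e : Bool), Run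
      (forEach .team (fun b : Bool => .push .team2 b ;;
        .pop .vec fun x => if b && x == some false then setFlag .acc () else .skip) : Prog k)
      { S with team := ts.map D.team, team2 := as, vec := ts.map x, acc := flag e }
      (some { S with team := [], team2 := (ts.map D.team).reverse ++ as, vec := [],
                     acc := flag (e || ts.any fun s => D.team s && !x s) })
      (6 * ts.length + 2) := by
    intro ts
    induction ts with
    | nil => exact fun as e => (Run.forEach_nil rfl).congr (by simp)
    | cons t ts ih =>
      intro as e
      refine ((Run.forEach_cons rfl ((Run.push _ _ _).seq (Run.pop_cons rfl (t := 2) ?_))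
        (ih (D.team t :: as) (e || (D.team t && !x t)))).congr ?_).mono ?_
      · split_ifs with hc
        · refine (run_setFlag_acc _ e rfl).congr ?_
          simp at hc
          simp [hc]
        · refine ((Run.skip _).mono (by omega)).congr ?_
          simp at hc
          cases hT : D.team t <;> simp_all
      · simp [Bool.or_assoc]
      · simp
        omega
  refine ((((main D.worlds [] false).congr' ?_).seq ((run_move_team2 _).seq
    (Run.pop (t := 2) (o := some { S with
        vec := []
        ok := flag (f || !D.worlds.any fun s => D.team s && !x s) }) ?_))).congr rfl).mono ?_
  · ext1 <;> simp [*, flag]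
  · cases he : D.worlds.any fun s => D.team s && !x s
    · refine (run_setFlag_ok _ f (by simp [hf])).congr ?_
      simp [flag, hT, hacc, hT2]
    · refine ((Run.skip _).mono (by omega)).congr ?_
      simp [flag, hT, hacc, hT2, hf]
  · simp
    omega

/-- All stacks that hold the structure and the team, and the auxiliary stacks, are in order. -/
def Ready (D : MCTable) (S : MCState k) : Prop :=
  RelReady D S ∧ S.team = D.worlds.map D.team ∧ S.team2 = [] ∧ S.val2 = [] ∧ S.vec = [] ∧
    S.path2 = [] ∧ S.lab2 = [] ∧ S.idx2 = [] ∧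
    S.lab = (encodeRows (List.finRange D.n) (List.finRange D.m) D.lab).reverse

/-- Check whether the team satisfies the formula that consists of the modalities on the stack
`path`, applied to a formula that holds in the worlds with data in `g`. -/
def checkProg (g : Bits k → Bool) : Prog k :=
  moveTo .val .val2 id ;; forEach .val2 (fun v => .push .val v ;; .push .vec (g v)) ;;
    pathProg ;; compareProg

theorem run_fill (g : Bits k → Bool) (S : MCState k) :
    Run (forEach .val2 (fun v => .push .val v ;; .push .vec (g v)) : Prog k) S
      (some { S with
        val2 := []
        val := S.val2.reverse ++ S.val
        vec := (S.val2.map g).reverse ++ S.vec }) (3 * S.val2.length + 2) := by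
  obtain ⟨l, hl⟩ : ∃ l, S.val2 = l := ⟨_, rfl⟩
  induction l generalizing S with
  | nil => exact ((Run.forEach_nil hl).congr (by simp [hl])).mono (by omega)
  | cons a l ih =>
    refine ((Run.forEach_cons hl ((Run.push _ _ _).seq (Run.push _ _ _)) (ih _ rfl)).congr
      ?_).mono ?_
    · simp [hl]
    · simp [hl]
      omega

/-- The data pass through `val2` and back, so two reversals cancel: `vec` lists the worlds in the
order of `team`, and `val` is intact for the next test. -/
theorem run_checkProg {D : MCTable} (g : Bits k → Bool) {S : MCState k} (hS : Ready D S)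
    {v : Fin D.n → Bits k} (hv : S.val = D.worlds.map v) {f : Bool} (hf : S.ok = flag f) :
    Run (checkProg g) S (some { S with ok := flag (f || D.check S.path fun s => g (v s)) })
      ((S.path.length + 1) * (16 * (D.n + 1) ^ 2)) := by
  obtain ⟨hr, hT, hT2, hv2, hvec, hp2, -⟩ := hS
  have h3 := run_compareProg (D := D) (S := { S with
    vec := D.worlds.map (D.applyPath S.path fun s => g (v s)) }) hT hT2 hr.2.2.2.2 rfl hf
  have h2 := run_pathProg (D := D) (S := { S with vec := D.worlds.map fun s => g (v s) })
    hr hp2 rfl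
  refine (((run_move_val S).seq ((run_fill g _).seq ((h2.seq h3).congr' ?_))).congr ?_).mono ?_
  · ext1 <;> simp [hv, hv2, hvec, Function.comp_def]
  · simp [MCTable.check, hvec]
  · simp [hv, hv2]
    ring_nf
    omega

/-- Check a list of alternatives. -/
def checksProg (gs : List (Bits k → Bool)) : Prog k :=
  gs.foldr (fun g q => checkProg g ;; q) .skip

theorem run_checksProg {D : MCTable} (gs : List (Bits k → Bool)) {S : MCState k} (hS : Ready D S)
    {v : Fin D.n → Bits k} (hv : S.val = D.worlds.map v) {f : Bool} (hf : S.ok = flag f) :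
    Run (checksProg gs) S
      (some { S with ok := flag (f || gs.any fun g => D.check S.path fun s => g (v s)) })
      (gs.length * ((S.path.length + 1) * (16 * (D.n + 1) ^ 2)) + 1) := by
  induction gs generalizing S f with
  | nil => exact ((Run.skip _).congr (by simp [← hf])).mono (by omega)
  | cons g gs ih =>
    refine (((run_checkProg g hS hv hf).seq (ih
      (S := { S with ok := flag (f || D.check S.path fun s => g (v s)) }) hS hv rfl)).congr ?_).mono ?_
    · simp [Bool.or_assoc]
    · simp
      ring_nf
      omega

/-! ### Looking up a column of the labelling matrix -/

/-- Add a bit to the data on a world. -/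
def consBits (b : Bool) (v : Bits k) : Bits k :=
  ⟨(b :: v.1).take (k + 1), by simp⟩

/-- Read an entry of the labelling matrix, or the end of a row. -/
def colStep : Option Bool → Prog k
  | some b => .pop .idx fun c => match (c : Option Bool) with
    | none => .skip
    | some true => .push .idx2 true
    | some false => .push .idx2 false ;;
        .pop .val2 fun v => v.elim .fail fun v => .push .val (consBits b v)
  | none => .pop .idx fun c => if c.isSome then .fail else moveTo .idx2 .idx id

/-- Scan the labelling matrix. -/
def colLoop : Prog k :=
  forEach .lab2 fun c => .push .lab c ;; colStep c

/-- Add a column of the labelling matrix to the data on the worlds. -/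
def colProg : Prog k :=
  moveTo .lab .lab2 id ;; moveTo .val .val2 id ;; colLoop ;; forEach .idx fun _ => .skip

/-- An empty `idx` means that the wanted entry of the row has been passed. The rest of the row is
only copied, and the separator triggers the restoration of the index for the next row. -/
theorem run_col_row_skip (S : MCState k) {o : Option (MCState k)} {t : ℕ} (row : List Bool)
    (rest ls : List (Option Bool)) (is : List Bool)
    (h : Run colLoop { S with
      lab2 := rest
      lab := none :: (row.map some).reverse ++ ls
      idx := is.reverse
      idx2 := [] } o t) :
    Run colLoop { S with
      lab2 := row.map some ++ none :: rest
      lab := ls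
      idx := []
      idx2 := is } o (t + 4 * row.length + 2 * is.length + 5) := by
  induction row generalizing ls with
  | nil =>
    refine (Run.forEach_cons rfl ((Run.push _ _ _).seq (Run.pop_nil rfl (run_move_idx2 _)))
      (h.congr' ?_)).mono ?_
    · simp
    · simp
      omega
  | cons b row ih =>
    refine (Run.forEach_cons rfl ((Run.push _ _ _).seq (Run.pop_nil rfl (Run.skip _)))
      (ih (some b :: ls) (h.congr' ?_))).mono ?_
    · simp
    · simp
      omega

/-- The unary index is consumed in step with the row, one symbol per entry, so its terminator
`false` meets exactly the entry at position `p`. -/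
theorem run_col_row (S : MCState k) {o : Option (MCState k)} {t : ℕ} (row : List Bool)
    (rest ls : List (Option Bool)) (is : List Bool) (p : ℕ) {b : Bool} (hp : row[p]? = some b)
    (v : Bits k) (vs ws : List (Bits k))
    (h : Run colLoop { S with
      lab2 := rest
      lab := none :: (row.map some).reverse ++ ls
      idx := is.reverse ++ List.replicate p true ++ [false]
      idx2 := []
      val2 := vs
      val := consBits b v :: ws } o t) :
    Run colLoop { S with
      lab2 := row.map some ++ none :: rest
      lab := ls
      idx := List.replicate p true ++ [false]
      idx2 := is
      val2 := v :: vs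
      val := ws } o (t + 6 * row.length + 2 * (is.length + p + 1) + 5) := by
  induction row generalizing ls is p with
  | nil => simp at hp
  | cons a row ih =>
    cases p with
    | zero =>
      obtain rfl : a = b := by simpa using hp
      refine (Run.forEach_cons rfl ((Run.push _ _ _).seq (Run.pop_cons rfl ((Run.push _ _ _).seq
        (Run.pop_cons rfl (Run.push _ _ _))))) ((run_col_row_skip (t := t) { S with
          val2 := vs
          val := consBits a v :: ws } row rest (some a :: ls) (false :: is)
          (h.congr' ?_)).congr' ?_)).mono ?_
      · simp
      · simp
      · simp
        omega
    | succ p =>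
      refine (Run.forEach_cons rfl ((Run.push _ _ _).seq (Run.pop_cons rfl (t := 1) ?_))
        (ih (some a :: ls) (true :: is) p (by simpa using hp) (h.congr' ?_))).mono ?_
      · exact Run.push (Γ := Stk.Alph k) .idx2 true _
      · simp [List.replicate_succ]
      · simp
        omega

/-- If the index is too large, part of it is left when the separator of the row arrives. This is how
an index that names no proposition is detected. -/
theorem run_col_row_fail (S : MCState k) (row : List Bool) (p : ℕ) (hp : row[p]? = none)
    (rest : List (Option Bool)) (h1 : S.lab2 = row.map some ++ none :: rest)
    (h2 : S.idx = List.replicate p true ++ [false]) :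
    Run colLoop S none (4 * row.length + 4) := by
  induction row generalizing S p with
  | nil =>
    cases p <;>
      exact (Run.forEach_fail h1 ((Run.push _ _ _).seq (Run.pop_cons h2 (Run.fail _)))).mono
        (by simp)
  | cons a row ih =>
    cases p with
    | zero => simp at hp
    | succ p =>
      refine (Run.forEach_cons h1 ((Run.push _ _ _).seq (Run.pop_cons h2 (Run.push _ _ _)))
        (ih _ p (by simpa using hp) rfl rfl)).mono ?_
      simp
      omega

theorem run_colLoop {ι κ : Type} (S : MCState k) (ts : List κ) (L : ι → κ → Bool) (c : ι → Bool)
    (p : ℕ) (hc : ∀ s, (ts.map (L s))[p]? = some (c s)) (v : ι → Bits k) (ss : List ι)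
    (ls : List (Option Bool)) (ws : List (Bits k)) (h1 : S.lab2 = encodeRows ss ts L)
    (h2 : S.lab = ls) (h3 : S.val2 = ss.map v) (h4 : S.val = ws)
    (h5 : S.idx = List.replicate p true ++ [false]) (h6 : S.idx2 = []) :
    Run colLoop S (some { S with
      lab2 := []
      lab := (encodeRows ss ts L).reverse ++ ls
      val2 := []
      val := (ss.map fun s => consBits (c s) (v s)).reverse ++ ws })
      (ss.length * (6 * ts.length + 2 * p + 7) + 2) := by
  induction ss generalizing S ls ws with
  | nil =>
    refine ((Run.forEach_nil (h1.trans rfl)).congr ?_).mono (by omega)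
    simp [encodeRows, h3, ← h2, ← h4]
  | cons s ss ih =>
    have := run_col_row S (ts.map (L s)) (encodeRows ss ts L) ls [] p (hc s) (v s) (ss.map v) ws
      (ih _ _ _ rfl rfl rfl rfl rfl rfl)
    refine ((this.congr' ?_).congr ?_).mono ?_
    · ext1 <;> simp [*, encodeRows]
    · simp [encodeRows, h5, h6]
    · simp
      ring_nf
      omega

/-- Moving `lab` and `val` to their partners reverses both, so the rows of the matrix and the data
on the worlds come up in the same order; the scan itself reverses them back. -/
theorem run_colProg {D : MCTable} (hn : 0 < D.n) {S : MCState k} (hS : Ready D S)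
    {v : Fin D.n → Bits k} (hv : S.val = D.worlds.map v) {p : ℕ}
    (hp : S.idx = List.replicate p true ++ [false]) :
    Run colProg S (if h : p < D.m then some { S with
        idx := []
        val := D.worlds.map fun s => consBits (D.lab s ⟨p, h⟩) (v s) } else none)
      (20 * ((D.n + 1) * (D.m + 1))) := by
  obtain ⟨-, -, -, hv2, -, -, hl2, hi2, hl⟩ := hS
  by_cases h : p < D.m
  · rw [dif_pos h]
    refine (((run_move_lab S).seq ((run_move_val _).seq ((run_colLoop (ι := Fin D.n)
      (κ := Fin D.m) _ (List.finRange D.m) D.lab (fun s => D.lab s ⟨p, h⟩) p ?_ v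
      (List.finRange D.n) [] [] ?_ ?_ ?_ ?_ ?_ ?_).seq (Run.clear _)))).congr ?_).mono ?_
    · simp [h]
    · simp [hl, hl2]
    · simp
    · simp [hv, hv2, MCTable.worlds]
    · simp
    · simp [hp]
    · simp [hi2]
    · simp [hl, hl2, hv2, MCTable.worlds]
    · simp [hl, hv, hp, length_encodeRows]
      have : D.n * p ≤ D.n * D.m := Nat.mul_le_mul_left _ h.le
      ring_nf
      omega
  · rw [dif_neg h]
    obtain ⟨n, hn'⟩ : ∃ n, D.n = n + 1 := ⟨D.n - 1, by omega⟩
    -- The failure happens at the end of the first row. Without any world there would be no row, and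
    -- a wrong index would pass unnoticed.
    have hne : List.finRange D.n ≠ [] := by simp; omega
    obtain ⟨s, ss, hss⟩ := List.exists_cons_of_ne_nil hne
    refine ((run_move_lab S).seq ((run_move_val _).seq (Run.seq_fail (run_col_row_fail _
      ((List.finRange D.m).map (D.lab s)) p ?_ (encodeRows ss (List.finRange D.m) D.lab)
      ?_ ?_)))).mono ?_
    · simpa using h
    · simp [hl, hl2, hss, encodeRows]
    · simp [hp]
    · simp [hl, hv, length_encodeRows]
      ring_nf
      omega

/-! ### Reading numerals, propositions and dependence atoms -/

/-- Read a unary numeral. -/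
def takeUnary : List MCSymbol → Option (ℕ × List MCSymbol)
  | .one :: w => (takeUnary w).map fun q => (q.1 + 1, q.2)
  | .zero :: w => some (0, w)
  | _ => none

/-- Read a symbol of a unary numeral. -/
def unaryStep (s : Stk) (a : s.Alph k) : Option MCSymbol → Prog k
  | some .one => .push s a
  | some .zero => .skip
  | _ => .fail

/-- Read a unary numeral from the input to the stack `s`. -/
def readUnary (s : Stk) (a : s.Alph k) : Prog k :=
  .loop .inp (fun c : Option MCSymbol => c == some .one) (unaryStep s a)

theorem run_readUnary (s : Stk) (hs : s ≠ .inp) (a : s.Alph k) (S : MCState k) :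
    Run (readUnary s a) S ((takeUnary S.inp).map fun q =>
      (S.set .inp q.2).set s (List.replicate q.1 a ++ S.get s)) (2 * S.inp.length + 2) := by
  obtain ⟨w, hw⟩ : ∃ w : List MCSymbol, StackStore.get S Stk.inp = w := ⟨_, rfl⟩
  -- As `s` is a variable, record updates on it do not compute; the proof uses only the laws of
  -- `StackStore`.
  change Run (readUnary s a) S ((takeUnary (StackStore.get S Stk.inp)).map fun q =>
      StackStore.set (StackStore.set S Stk.inp q.2) s (List.replicate q.1 a ++ StackStore.get S s))
      (2 * (StackStore.get S Stk.inp).length + 2)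
  induction w generalizing S with
  | nil =>
    exact ((Run.loop_exit_nil hw rfl (Run.fail _)).congr (by rw [hw]; rfl)).mono (by omega)
  | cons c w ih =>
    have hi : StackStore.get (StackStore.set (StackStore.set S Stk.inp w) s
        (a :: StackStore.get (StackStore.set S Stk.inp w) s)) Stk.inp = w := by
      rw [get_set_ne _ hs.symm, get_set_self]
    by_cases h1 : c = .one
    · subst h1
      refine ((Run.loop_next_cons hw rfl (Run.push _ _ _) (ih _ hi)).congr ?_).mono ?_
      · rw [hw, hi]
        simp only [takeUnary, Option.map_map]
        congr 1
        funext q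
        refine StackStore.ext (Γ := Stk.Alph k) fun s' => ?_
        rcases eq_or_ne s' s with rfl | hs'
        · rw [Function.comp, get_set_self, get_set_self, get_set_self, get_set_ne _ hs,
            List.replicate_succ', List.append_assoc]
          rfl
        · rw [Function.comp, get_set_ne _ hs', get_set_ne _ hs']
          rcases eq_or_ne s' Stk.inp with rfl | hi'
          · rw [get_set_self, get_set_self]
          · rw [get_set_ne _ hi', get_set_ne _ hs', get_set_ne _ hi', get_set_ne _ hi']
      · rw [hw, hi, List.length_cons]
        omega
    · by_cases h0 : c = .zero
      · subst h0
        refine ((Run.loop_exit_cons hw rfl (Run.skip _)).congr ?_).mono (by simp)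
        rw [hw]
        refine congrArg some (StackStore.ext (Γ := Stk.Alph k) fun s' => ?_)
        rcases eq_or_ne s' s with rfl | hs'
        · rw [get_set_self, get_set_ne _ hs]
          rfl
        · rw [get_set_ne _ hs']
      · refine ((Run.loop_exit_cons hw (by simpa using h1) (o := none) (t := 1) ?_).congr ?_).mono
          (by simp)
        · cases c <;> first | exact absurd rfl h1 | exact absurd rfl h0 | exact Run.fail _
        · rw [hw]
          cases c <;> first | exact absurd rfl h1 | exact absurd rfl h0 | rfl

/-- Unary notation makes the word at least as long as the number. This bounds the numbers of worlds
and propositions by the input length, on which the time bounds rest. -/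
theorem length_takeUnary {w r : List MCSymbol} {p : ℕ} (h : takeUnary w = some (p, r)) :
    r.length + p + 1 = w.length := by
  induction w generalizing p with
  | nil => simp [takeUnary] at h
  | cons c w ih =>
    cases c <;> simp only [takeUnary, reduceCtorEq] at h
    · simp_all
    · obtain ⟨⟨p', r'⟩, h1, h2⟩ := Option.map_eq_some_iff.1 h
      obtain ⟨rfl, rfl⟩ := Prod.mk.inj h2
      have := ih h1
      simp
      omega

/-- Read the index of a proposition, and add the truth values of the proposition to the data on
the worlds. -/
def takeCol (D : MCTable) (w : List MCSymbol) (v : Fin D.n → Bits k) :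
    Option ((Fin D.n → Bits k) × List MCSymbol) :=
  (takeUnary w).bind fun q => if h : q.1 < D.m then
    some (fun s => consBits (D.lab s ⟨q.1, h⟩) (v s), q.2) else none

/-- Read a proposition, and add its truth values to the data on the worlds. -/
def takeLast (D : MCTable) : List MCSymbol → (Fin D.n → Bits k) →
    Option ((Fin D.n → Bits k) × List MCSymbol)
  | .prop :: w, v => takeCol D w v
  | _, _ => none

/-- Read at most `j` propositions, a semicolon and a proposition. -/
def takeDep (D : MCTable) : ℕ → List MCSymbol → (Fin D.n → Bits k) →
    Option ((Fin D.n → Bits k) × List MCSymbol)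
  | _, .semicolon :: w, v => takeLast D w v
  | j + 1, .prop :: w, v => (takeCol D w v).bind fun q => takeDep D j q.2 q.1
  | _, _, _ => none

/-- The program for `takeCol`. -/
def readCol : Prog k :=
  .push .idx false ;; readUnary .idx true ;; colProg

/-- The first step of the program for `takeLast`. -/
def lastStep : Option MCSymbol → Prog k
  | some .prop => readCol
  | _ => .fail

/-- The program for `takeLast`. -/
def readLast : Prog k :=
  .pop .inp lastStep

/-- A step of the program for `takeDep`, followed by `p` after a proposition. -/
def depStep (p : Prog k) : Option MCSymbol → Prog k
  | some .semicolon => readLast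
  | some .prop => p
  | _ => .fail

/-- The program for `takeDep`. -/
def readDep : ℕ → Prog k
  | 0 => .pop .inp (depStep .fail)
  | j + 1 => .pop .inp (depStep (readCol ;; readDep j))

/-- The state after the data on the worlds have been changed. -/
def putVal (D : MCTable) (S : MCState k) (q : (Fin D.n → Bits k) × List MCSymbol) : MCState k :=
  { S with inp := q.2, val := D.worlds.map q.1 }

theorem length_takeCol {D : MCTable} {w : List MCSymbol} {v : Fin D.n → Bits k}
    {q : (Fin D.n → Bits k) × List MCSymbol} (h : takeCol D w v = some q) :
    q.2.length < w.length := by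
  obtain ⟨⟨p, r⟩, h1, h2⟩ := Option.bind_eq_some_iff.1 h
  have := length_takeUnary h1
  split_ifs at h2
  obtain rfl := Option.some_injective _ h2
  simp
  omega

theorem length_takeLast {D : MCTable} {w : List MCSymbol} {v : Fin D.n → Bits k}
    {q : (Fin D.n → Bits k) × List MCSymbol} (h : takeLast D w v = some q) :
    q.2.length < w.length := by
  unfold takeLast at h
  split at h
  · have := length_takeCol h
    simp
    omega
  · cases h

theorem length_takeDep {D : MCTable} {j : ℕ} {w : List MCSymbol} {v : Fin D.n → Bits k}
    {q : (Fin D.n → Bits k) × List MCSymbol} (h : takeDep D j w v = some q) :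
    q.2.length < w.length := by
  induction j generalizing w v with
  | zero =>
    unfold takeDep at h
    split at h
    · have := length_takeLast h
      simp
      omega
    · omega
    · cases h
  | succ j ih =>
    rcases w with - | ⟨c, w⟩
    · simp [takeDep] at h
    · cases c <;> simp only [takeDep, reduceCtorEq] at h
      · obtain ⟨q', h1, h2⟩ := Option.bind_eq_some_iff.1 h
        have := length_takeCol h1
        have := ih h2
        simp
        omega
      · have := length_takeLast h
        simp
        omega

theorem run_readCol {D : MCTable} (hn : 0 < D.n) {S : MCState k} (hS : Ready D S)
    (hi : S.idx = []) {v : Fin D.n → Bits k} (hv : S.val = D.worlds.map v) {B : ℕ}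
    (hB : S.inp.length ≤ B) (hnB : D.n ≤ B) (hmB : D.m ≤ B) :
    Run readCol S ((takeCol D S.inp v).map (putVal D S)) (30 * (B + 1) ^ 2) := by
  -- The terminator `false` is put at the bottom of `idx` first, as the ones are then pushed on top
  -- of it.
  have h2 := run_readUnary Stk.idx (by decide) true { S with idx := [false] }
  have ht : 20 * ((D.n + 1) * (D.m + 1)) ≤ 20 * (B + 1) ^ 2 := by
    rw [pow_two]
    gcongr
  have h1 := Run.push (Γ := Stk.Alph k) .idx false S
  replace h1 := h1.congr (o' := some { S with idx := [false] }) (by simp [hi])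
  simp only at h2
  rw [takeCol]
  rcases h : takeUnary S.inp with - | ⟨p, r⟩
  · rw [h] at h2
    refine (h1.seq (Run.seq_fail h2)).mono ?_
    nlinarith
  · rw [h] at h2
    refine ((h1.seq (h2.seq (run_colProg (D := D) (v := v) (p := p) hn (by exact hS) (by exact hv)
      (by simp)))).congr ?_).mono ?_
    · by_cases hp : p < D.m
      · simp [hp, putVal, hi]
      · simp [hp]
    · nlinarith

theorem run_readLast {D : MCTable} (hn : 0 < D.n) {S : MCState k} (hS : Ready D S)
    (hi : S.idx = []) {v : Fin D.n → Bits k} (hv : S.val = D.worlds.map v) {B : ℕ}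
    (hB : S.inp.length ≤ B) (hnB : D.n ≤ B) (hmB : D.m ≤ B) :
    Run readLast S ((takeLast D S.inp v).map (putVal D S)) (30 * (B + 1) ^ 2 + 1) := by
  have hE : 1 ≤ (B + 1) ^ 2 := Nat.one_le_pow _ _ (by omega)
  rcases h : S.inp with - | ⟨c, w⟩
  · exact ((Run.pop_nil h (Run.fail _)).congr rfl).mono (by omega)
  · by_cases hc : c = .prop
    · subst hc
      refine (Run.pop_cons h (run_readCol hn (by exact hS) (by exact hi) (by exact hv) (B := B)
        ?_ hnB hmB)).congr rfl
      simp [h] at hB ⊢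
      omega
    · refine ((Run.pop_cons h (o := none) (t := 1) ?_).congr ?_).mono (by omega)
      · cases c <;> first | exact absurd rfl hc | exact Run.fail _
      · cases c <;> first | exact absurd rfl hc | rfl

/-- The program is unrolled `j` times, once for each admissible argument. With `j = k` fixed this is
a constant number of scans of the labelling matrix, and longer argument lists run into `fail`. -/
theorem run_readDep {D : MCTable} (hn : 0 < D.n) (j : ℕ) {S : MCState k} (hS : Ready D S)
    (hi : S.idx = []) {v : Fin D.n → Bits k} (hv : S.val = D.worlds.map v) {B : ℕ}
    (hB : S.inp.length ≤ B) (hnB : D.n ≤ B) (hmB : D.m ≤ B) :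
    Run (readDep j) S ((takeDep D j S.inp v).map (putVal D S))
      ((j + 1) * (30 * (B + 1) ^ 2 + 2)) := by
  have hE : 1 ≤ (B + 1) ^ 2 := Nat.one_le_pow _ _ (by omega)
  induction j generalizing S v with
  | zero =>
    rcases h : S.inp with - | ⟨c, w⟩
    · exact ((Run.pop_nil h (Run.fail _)).congr rfl).mono (by omega)
    · by_cases hc : c = .semicolon
      · subst hc
        refine ((Run.pop_cons h (run_readLast hn (by exact hS) (by exact hi) (by exact hv) (B := B)
          ?_ hnB hmB)).congr rfl).mono (by omega)
        simp [h] at hB ⊢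
        omega
      · refine ((Run.pop_cons h (o := none) (t := 1) ?_).congr ?_).mono (by omega)
        · cases c <;> first | exact absurd rfl hc | exact Run.fail _
        · cases c <;> first | exact absurd rfl hc | rfl
  | succ j ih =>
    have ht : (j + 1 + 1) * (30 * (B + 1) ^ 2 + 2) =
      (j + 1) * (30 * (B + 1) ^ 2 + 2) + (30 * (B + 1) ^ 2 + 2) := by ring
    rcases h : S.inp with - | ⟨c, w⟩
    · exact ((Run.pop_nil h (Run.fail _)).congr rfl).mono (by omega)
    · have hw : w.length ≤ B := by
        simp [h] at hB
        omega
      by_cases hc : c = .semicolon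
      · subst hc
        exact ((Run.pop_cons h (run_readLast hn (by exact hS) (by exact hi) (by exact hv) (B := B)
          hw hnB hmB)).congr rfl).mono (by omega)
      · by_cases hc' : c = .prop
        · subst hc'
          have h1 := run_readCol (S := { S with inp := w }) hn hS hi hv hw hnB hmB
          rw [takeDep]
          simp only at h1
          rcases h2 : takeCol D w v with - | q
          · rw [h2] at h1
            exact (Run.pop_cons h (Run.seq_fail h1)).mono (by omega)
          · rw [h2] at h1
            have := length_takeCol h2
            refine ((Run.pop_cons h (h1.seq (ih (by exact hS) (by exact hi) rfl ?_))).congr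
              ?_).mono ?_
            · exact (by simp [putVal]; omega)
            · rfl
            · omega
        · refine ((Run.pop_cons h (o := none) (t := 1) ?_).congr ?_).mono (by omega)
          · cases c <;> first | exact absurd rfl hc | exact absurd rfl hc' | exact Run.fail _
          · cases c <;> first | exact absurd rfl hc | exact absurd rfl hc' | rfl

/-! ### Completed formulae and atomic formulae -/

/-- The path of the formula that follows a completed formula, if there is one. -/
def unwind : List (Option Bool) → Option (List (Option Bool))
  | [] => none
  | none :: p => some p
  | some _ :: p => unwind p

theorem length_unwind {p p' : List (Option Bool)} (h : unwind p = some p') :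
    p'.length < p.length := by
  induction p with
  | nil => simp [unwind] at h
  | cons c p ih =>
    cases c with
    | none =>
      obtain rfl := Option.some_injective _ h
      simp
    | some b =>
      have := ih h
      simp
      omega

/-- Fail unless the input has been read. -/
def endStep (c : Option MCSymbol) : Prog k :=
  if c.isSome then .fail else .skip

/-- A step of `unwindProg`. -/
def unwindStep : Option (Option Bool) → Prog k
  | none => .pop .inp endStep
  | some none => .push .todo ()
  | some (some _) => .skip

/-- Remove the modalities of a completed formula from the stack `path`. -/
def unwindProg : Prog k :=
  .loop .path (fun c : Option (Option Bool) => (c.getD none).isSome) unwindStep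

/-- The state after a completed formula. -/
def unwindResult (S : MCState k) : Option (MCState k) :=
  match unwind S.path with
  | none => if S.inp = [] then some { S with path := [] } else none
  | some p => some { S with path := p, todo := () :: S.todo }

/-- The loop stops at a pending `⊻` and requests its second disjunct by a symbol on `todo`. If none
is pending, the whole formula has been read and the input must be exhausted. -/
theorem run_unwindProg (S : MCState k) :
    Run unwindProg S (unwindResult S) (2 * S.path.length + 3) := by
  obtain ⟨p, hp⟩ : ∃ p, S.path = p := ⟨_, rfl⟩
  induction p generalizing S with
  | nil =>
    rcases hi : S.inp with - | ⟨c, w⟩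
    · refine ((Run.loop_exit_nil hp rfl (Run.pop_nil hi (Run.skip _))).congr ?_).mono (by omega)
      simp only [unwindResult, hp, unwind, hi, if_true]
      simp [← hi]
    · refine ((Run.loop_exit_nil hp rfl (Run.pop_cons hi (Run.fail _))).congr ?_).mono (by omega)
      simp [unwindResult, hp, unwind, hi]
  | cons c p ih =>
    cases c with
    | none =>
      refine ((Run.loop_exit_cons hp rfl (Run.push _ _ _)).congr ?_).mono (by omega)
      simp [unwindResult, hp, unwind]
    | some b =>
      refine ((Run.loop_next_cons hp rfl (Run.skip _) (ih _ rfl)).congr ?_).mono ?_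
      · simp only [unwindResult, hp, unwind, MCState.store_set, MCState.set]
        cases unwind p <;> rfl
      · simp [hp]
        omega

/-- Empty data on the worlds. -/
def nilBits : Bits k := ⟨[], by simp⟩

/-- Initialize the data on the worlds. -/
def initVal : Prog k :=
  forEach .team (fun b => .push .team2 b ;; .push .val nilBits) ;; moveTo .team2 .team id

/-- The team serves only as a counter here: its stack has one symbol per world. -/
theorem run_initVal {D : MCTable} {S : MCState k} (hS : Ready D S) (hv : S.val = []) :
    Run initVal S (some { S with val := D.worlds.map fun _ => nilBits }) (5 * D.n + 4) := by
  have main : ∀ (ts : List Bool) (as : List Bool) (vs : List (Bits k)), Run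
      (forEach .team (fun b => .push .team2 b ;; .push .val nilBits) : Prog k)
      { S with team := ts, team2 := as, val := vs }
      (some { S with team := [], team2 := ts.reverse ++ as,
                     val := List.replicate ts.length nilBits ++ vs }) (3 * ts.length + 2) := by
    intro ts
    induction ts with
    | nil => exact fun as vs => (Run.forEach_nil rfl).congr (by simp)
    | cons t ts ih =>
      intro as vs
      refine ((Run.forEach_cons rfl (Run.seq (t' := 1) (Run.push _ _ _) ?_)
        (ih (t :: as) (nilBits :: vs))).congr ?_).mono ?_
      · exact Run.push (Γ := Stk.Alph k) .val nilBits _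
      · simp [List.replicate_succ']
      · simp
        omega
  obtain ⟨-, hT, hT2, -⟩ := hS
  refine ((((main (D.worlds.map D.team) [] []).congr' ?_).seq (run_move_team2 _)).congr ?_).mono ?_
  · rw [← hT, ← hT2, ← hv]
  · simp [hT, hT2, List.map_const']
  · simp
    omega

/-- Read an atomic formula with `rd` and check it by means of the tests `gs`. -/
def leafProg (rd : Prog k) (gs : List (Bits k → Bool)) : Prog k :=
  initVal ;; rd ;; checksProg gs ;; (forEach .val fun _ => .skip) ;; unwindProg

/-- The state after an atomic formula. -/
def leafResult (D : MCTable) (S : MCState k) (f : Bool) (gs : List (Bits k → Bool))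
    (q : (Fin D.n → Bits k) × List MCSymbol) : Option (MCState k) :=
  unwindResult { S with
    inp := q.2
    ok := flag (f || gs.any fun g => D.check S.path fun s => g (q.1 s)) }

theorem run_leafProg {D : MCTable} {S : MCState k} (hS : Ready D S) (hv : S.val = [])
    {f : Bool} (hf : S.ok = flag f) {rd : Prog k} {gs : List (Bits k → Bool)}
    {o : Option ((Fin D.n → Bits k) × List MCSymbol)} {t : ℕ}
    (h : Run rd { S with val := D.worlds.map fun _ => nilBits } (o.map (putVal D S)) t) :
    Run (leafProg rd gs) S (o.bind (leafResult D S f gs))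
      (t + gs.length * ((S.path.length + 1) * (16 * (D.n + 1) ^ 2)) + 7 * D.n +
        2 * S.path.length + 10) := by
  cases o with
  | none => exact ((run_initVal hS hv).seq (Run.seq_fail h)).mono (by omega)
  | some q =>
    refine (((run_initVal hS hv).seq (h.seq ((run_checksProg (D := D) gs (by exact hS) rfl
      (by exact hf)).seq ((Run.clear _).seq (run_unwindProg _))))).congr ?_).mono ?_
    · simp [leafResult, putVal, ← hv]
    · simp [putVal]
      omega

/-! ### One item of the input and its cost -/

/-- A symbol of the word of a formula, or an atomic formula, given by tests on data on the
worlds. -/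
inductive Item (D : MCTable) (k : ℕ)
  | op (c : Option Bool)
  | leaf (gs : List (Bits k → Bool)) (v : Fin D.n → Bits k)

/-- The last bit that has been read. -/
def headBit (v : Bits k) : Bool := v.1.headD false

/-- All bits but the last one that has been read. -/
def tailBits (v : Bits k) : Bits k := ⟨v.1.tail, by have := v.2; simp; omega⟩

/-- The tests for a dependence atom: the last bit is a given function of the others. -/
noncomputable def depTests (k : ℕ) : List (Bits k → Bool) :=
  (Set.finite_univ (α := Bits k → Bool)).toFinset.toList.map fun f v => headBit v == f (tailBits v)

open Classical in
/-- Read the item that follows a negation. -/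
noncomputable def nextNeg (D : MCTable) (M : Set MDLOp) :
    List MCSymbol → Option (Item D k × List MCSymbol)
  | .prop :: w => (takeCol D w fun _ => nilBits).map fun q =>
      (.leaf [fun v => !headBit v] q.1, q.2)
  | .dep :: w => if MDLOp.dep ∈ M then (takeDep D k w fun _ => nilBits).map fun q =>
      (.leaf [fun _ => false] q.1, q.2) else none
  | _ => none

open Classical in
/-- Read an item. -/
noncomputable def next (D : MCTable) (M : Set MDLOp) :
    List MCSymbol → Option (Item D k × List MCSymbol)
  | .box :: w => if MDLOp.box ∈ M then some (.op (some true), w) else none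
  | .dia :: w => if MDLOp.dia ∈ M then some (.op (some false), w) else none
  | .cor :: w => if MDLOp.cor ∈ M then some (.op none, w) else none
  | .prop :: w => (takeCol D w fun _ => nilBits).map fun q => (.leaf [headBit] q.1, q.2)
  | .neg :: w => if MDLOp.neg ∈ M then nextNeg D M w else none
  | .dep :: w => if MDLOp.dep ∈ M then (takeDep D k w fun _ => nilBits).map fun q =>
      (.leaf (depTests k) q.1, q.2) else none
  | _ => none

/-- Put an operator on the stack `path`. -/
def opProg (c : Option Bool) : Prog k :=
  .push .path c ;; .push .todo ()

open Classical in
/-- Handle the item that follows a negation. -/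
noncomputable def negStep (M : Set MDLOp) : Option MCSymbol → Prog k
  | some .prop => leafProg readCol [fun v => !headBit v]
  | some .dep => if MDLOp.dep ∈ M then leafProg (readDep k) [fun _ => false] else .fail
  | _ => .fail

open Classical in
/-- Handle an item. -/
noncomputable def itemStep (M : Set MDLOp) : Option MCSymbol → Prog k
  | some .box => if MDLOp.box ∈ M then opProg (some true) else .fail
  | some .dia => if MDLOp.dia ∈ M then opProg (some false) else .fail
  | some .cor => if MDLOp.cor ∈ M then opProg none else .fail
  | some .prop => leafProg readCol [headBit]
  | some .neg => if MDLOp.neg ∈ M then .pop .inp (negStep M) else .fail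
  | some .dep => if MDLOp.dep ∈ M then leafProg (readDep k) (depTests k) else .fail
  | _ => .fail

/-- The state after an item. -/
def itemResult (D : MCTable) (S : MCState k) (f : Bool) :
    Item D k × List MCSymbol → Option (MCState k)
  | (.op c, w) => some { S with inp := w, path := c :: S.path, todo := () :: S.todo }
  | (.leaf gs v, w) => leafResult D S f gs (v, w)

/-- A bound for the time needed for an item. -/
noncomputable def itemTime (k B : ℕ) : ℕ :=
  ((k + 1) * 32 + ((depTests k).length + 1) * 16 + 20) * (B + 1) ^ 3

theorem run_opProg {D : MCTable} (c : Option Bool) (S : MCState k) (f : Bool) :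
    Run (opProg c) S (itemResult D S f (.op c, S.inp)) 2 :=
  ((Run.push _ _ _).seq (Run.push _ _ _)).congr rfl

/-- The dominant term is (number of tests) × (length of the path) × (size of the accessibility
matrix), cubic in `B` because the number of tests is bounded in terms of `k`. The extra two steps
pay for popping `neg` and the symbol after it. -/
theorem leaf_time {k B b p n t : ℕ} (hb : b ≤ (depTests k).length + 1) (hp : p ≤ B) (hn : n ≤ B)
    (ht : t ≤ (k + 1) * (30 * (B + 1) ^ 2 + 2)) :
    t + b * ((p + 1) * (16 * (n + 1) ^ 2)) + 7 * n + 2 * p + 10 + 2 ≤ itemTime k B := by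
  have h1 : b * ((p + 1) * (16 * (n + 1) ^ 2)) ≤
      ((depTests k).length + 1) * ((B + 1) * (16 * (B + 1) ^ 2)) := by gcongr
  have h2 : (k + 1) * (30 * (B + 1) ^ 2 + 2) ≤ (k + 1) * (32 * (B + 1) ^ 3) := by
    gcongr
    nlinarith [Nat.one_le_pow 2 (B + 1) (by omega), Nat.one_le_pow 3 (B + 1) (by omega),
      Nat.pow_le_pow_right (n := B + 1) (by omega) (show 2 ≤ 3 by omega)]
  have h3 : 7 * n + 2 * p + 12 ≤ 20 * (B + 1) ^ 3 := by
    have : B + 1 ≤ (B + 1) ^ 3 := Nat.le_self_pow (by omega) _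
    omega
  have : itemTime k B = (k + 1) * (32 * (B + 1) ^ 3) +
    ((depTests k).length + 1) * ((B + 1) * (16 * (B + 1) ^ 2)) + 20 * (B + 1) ^ 3 := by
    unfold itemTime
    ring
  omega

theorem run_leafCol {D : MCTable} (hn : 0 < D.n) {S : MCState k} (hS : Ready D S)
    (hi : S.idx = []) (hv : S.val = []) {f : Bool} (hf : S.ok = flag f) {B : ℕ}
    (hB : S.inp.length ≤ B) (hp : S.path.length ≤ B) (hnB : D.n ≤ B) (hmB : D.m ≤ B)
    (g : Bits k → Bool) :
    Run (leafProg readCol [g]) S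
      (((takeCol D S.inp fun _ => nilBits).map fun q => (Item.leaf [g] q.1, q.2)).bind
        (itemResult D S f)) (itemTime k B - 2) := by
  refine ((run_leafProg hS hv hf (run_readCol (S := { S with val := D.worlds.map fun _ => nilBits }) hn hS hi rfl hB hnB
    hmB)).congr ?_).mono ?_
  · rw [Option.bind_map]
    rfl
  · have := leaf_time (k := k) (b := 1) (t := 30 * (B + 1) ^ 2) (by omega) hp hnB (by nlinarith)
    simp only [List.length_singleton]
    omega

theorem run_leafDep {D : MCTable} (hn : 0 < D.n) {S : MCState k} (hS : Ready D S)
    (hi : S.idx = []) (hv : S.val = []) {f : Bool} (hf : S.ok = flag f) {B : ℕ}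
    (hB : S.inp.length ≤ B) (hp : S.path.length ≤ B) (hnB : D.n ≤ B) (hmB : D.m ≤ B)
    (gs : List (Bits k → Bool)) (hgs : gs.length ≤ (depTests k).length + 1) :
    Run (leafProg (readDep k) gs) S
      (((takeDep D k S.inp fun _ => nilBits).map fun q => (Item.leaf gs q.1, q.2)).bind
        (itemResult D S f)) (itemTime k B - 2) := by
  refine ((run_leafProg hS hv hf (run_readDep (S := { S with val := D.worlds.map fun _ => nilBits }) hn k hS hi rfl hB hnB
    hmB)).congr ?_).mono ?_
  · rw [Option.bind_map]
    rfl
  · have := leaf_time (k := k) (t := (k + 1) * (30 * (B + 1) ^ 2 + 2)) hgs hp hnB le_rfl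
    omega

theorem length_nextNeg {D : MCTable} {M : Set MDLOp} {w : List MCSymbol}
    {q : Item D k × List MCSymbol} (h : nextNeg D M w = some q) : q.2.length < w.length := by
  unfold nextNeg at h
  split at h
  · obtain ⟨q', h1, rfl⟩ := Option.map_eq_some_iff.1 h
    have := length_takeCol h1
    simp
    omega
  · split_ifs at h
    obtain ⟨q', h1, rfl⟩ := Option.map_eq_some_iff.1 h
    have := length_takeDep h1
    simp
    omega
  · cases h

/-- Every item consumes input. This makes `scan` terminate and bounds the number of items by the
length of the word. -/
theorem length_next {D : MCTable} {M : Set MDLOp} {w : List MCSymbol}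
    {q : Item D k × List MCSymbol} (h : next D M w = some q) : q.2.length < w.length := by
  unfold next at h
  split at h
  · split_ifs at h
    obtain rfl := Option.some_injective _ h
    simp
  · split_ifs at h
    obtain rfl := Option.some_injective _ h
    simp
  · split_ifs at h
    obtain rfl := Option.some_injective _ h
    simp
  · obtain ⟨q', h1, rfl⟩ := Option.map_eq_some_iff.1 h
    have := length_takeCol h1
    simp
    omega
  · split_ifs at h
    have := length_nextNeg h
    simp
    omega
  · split_ifs at h
    obtain ⟨q', h1, rfl⟩ := Option.map_eq_some_iff.1 h
    have := length_takeDep h1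
    simp
    omega
  · cases h

/-- Read and handle an item. -/
noncomputable def stepProg (M : Set MDLOp) : Prog k :=
  .pop .inp (itemStep M)

theorem ten_lt_itemTime (k B : ℕ) : 10 < itemTime k B := by
  have : 1 ≤ (B + 1) ^ 3 := Nat.one_le_pow _ _ (by omega)
  unfold itemTime
  nlinarith

theorem run_negStep {D : MCTable} (M : Set MDLOp) (hn : 0 < D.n) {S : MCState k} (hS : Ready D S)
    (hi : S.idx = []) (hv : S.val = []) {f : Bool} (hf : S.ok = flag f) {B : ℕ}
    (hB : S.inp.length ≤ B) (hp : S.path.length ≤ B) (hnB : D.n ≤ B) (hmB : D.m ≤ B) :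
    Run (.pop Stk.inp (negStep M) : Prog k) S ((nextNeg D M S.inp).bind (itemResult D S f))
      (itemTime k B - 1) := by
  have ht := ten_lt_itemTime k B
  rcases h : S.inp with - | ⟨c, w⟩
  · exact ((Run.pop_nil h (Run.fail _)).congr rfl).mono (by omega)
  · have hw : w.length ≤ B := by
      simp [h] at hB
      omega
    by_cases h1 : c = .prop
    · subst h1
      exact ((Run.pop_cons h (run_leafCol (S := { S with inp := w }) hn hS hi hv hf hw hp hnB hmB
        _)).congr rfl).mono (by omega)
    by_cases h2 : c = .dep
    · subst h2
      by_cases hM : MDLOp.dep ∈ M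
      · refine ((Run.pop_cons h (t := itemTime k B - 2) (o := ((takeDep D k w fun _ => nilBits).map
          fun q => (Item.leaf [fun _ => false] q.1, q.2)).bind (itemResult D S f)) ?_).congr
          ?_).mono (by omega)
        · rw [negStep, if_pos hM]
          exact run_leafDep (S := { S with inp := w }) hn hS hi hv hf hw hp hnB hmB _ (by simp)
        · rw [nextNeg, if_pos hM]
      · refine ((Run.pop_cons h (t := 1) (o := none) ?_).congr ?_).mono (by omega)
        · rw [negStep, if_neg hM]
          exact Run.fail _
        · rw [nextNeg, if_neg hM]
          rfl
    refine ((Run.pop_cons h (o := none) (t := 1) ?_).congr ?_).mono (by omega)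
    · cases c <;> first | exact absurd rfl h1 | exact absurd rfl h2 | exact Run.fail _
    · cases c <;> first | exact absurd rfl h1 | exact absurd rfl h2 | rfl

theorem run_stepProg {D : MCTable} (M : Set MDLOp) (hn : 0 < D.n) {S : MCState k} (hS : Ready D S)
    (hi : S.idx = []) (hv : S.val = []) {f : Bool} (hf : S.ok = flag f) {B : ℕ}
    (hB : S.inp.length ≤ B) (hp : S.path.length ≤ B) (hnB : D.n ≤ B) (hmB : D.m ≤ B) :
    Run (stepProg M) S ((next D M S.inp).bind (itemResult D S f)) (itemTime k B) := by
  have ht := ten_lt_itemTime k B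
  rcases h : S.inp with - | ⟨c, w⟩
  · exact ((Run.pop_nil h (Run.fail _)).congr rfl).mono (by omega)
  have hw : w.length ≤ B := by
    simp [h] at hB
    omega
  -- Membership in `M` is decided when the program is chosen, not by the machine; an operator
  -- outside `M` has `fail` as its code.
  have guarded : ∀ {op : MDLOp} {p : Prog k} {r : Option (Item D k × List MCSymbol)} {t : ℕ},
      t + 1 ≤ itemTime k B →
      Run p { S with inp := w } (r.bind (itemResult D S f)) t →
      (open Classical in Run (if op ∈ M then p else .fail) { S with inp := w }
        ((if op ∈ M then r else none).bind (itemResult D S f)) (itemTime k B - 1)) := by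
    intro op p r t ht' hr
    by_cases hM : op ∈ M
    · rw [if_pos hM, if_pos hM]
      exact hr.mono (by omega)
    · rw [if_neg hM, if_neg hM]
      exact (Run.fail _).mono (by omega)
  have finish : ∀ {o : Option (MCState k)},
      Run (itemStep M (some c)) { S with inp := w } o (itemTime k B - 1) →
      Run (stepProg M) S o (itemTime k B) :=
    fun hr => (Run.pop_cons h hr).mono (by omega)
  cases c with
  | box => exact finish (guarded (by omega) (run_opProg (D := D) _ _ f))
  | dia => exact finish (guarded (by omega) (run_opProg (D := D) _ _ f))
  | cor => exact finish (guarded (by omega) (run_opProg (D := D) _ _ f))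
  | prop =>
    exact finish ((run_leafCol (S := { S with inp := w }) hn hS hi hv hf hw hp hnB hmB _).mono
      (by omega))
  | neg =>
    exact finish (guarded (t := itemTime k B - 1) (by omega)
      (run_negStep (S := { S with inp := w }) M hn hS hi hv hf hw hp hnB hmB))
  | dep =>
    exact finish (guarded (t := itemTime k B - 2) (by omega)
      (run_leafDep (S := { S with inp := w }) hn hS hi hv hf hw hp hnB hmB _ (by simp)))
  | _ => exact finish ((Run.fail _).mono (by omega))

/-! ### Scanning a whole formula -/

/-- Continue after a completed formula under `path`: either another formula has to be read, or the
end of the word `w` is expected. -/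
def resume (path : List (Option Bool)) (w : List MCSymbol) (b : Bool)
    (next : List (Option Bool) → Option Bool) : Option Bool :=
  match unwind path with
  | none => if w = [] then some b else none
  | some p => next p

/-- Continue after an item. -/
def scanItem (D : MCTable) (path : List (Option Bool)) (b : Bool) (w : List MCSymbol)
    (cont : List (Option Bool) → Bool → Option Bool) : Item D k → Option Bool
  | .op c => cont (c :: path) b
  | .leaf gs v =>
    resume path w (b || gs.any fun g => D.check path fun s => g (v s)) fun p =>
      cont p (b || gs.any fun g => D.check path fun s => g (v s))

/-- Read a formula from `w` in the scope of the operators in `path`, and the remaining disjuncts of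
the disjunctions in `path`; `b` tells whether a disjunct that has been read before is satisfied. -/
noncomputable def scan (k : ℕ) (D : MCTable) (M : Set MDLOp) (w : List MCSymbol)
    (path : List (Option Bool)) (b : Bool) : Option Bool :=
  (next (k := k) D M w).bind fun q =>
    if _h : q.2.length < w.length then
      scanItem D path b q.2 (fun p b => scan k D M q.2 p b) q.1
    else none
  termination_by w.length

theorem scan_eq (D : MCTable) (M : Set MDLOp) (w : List MCSymbol) (path : List (Option Bool))
    (b : Bool) : scan k D M w path b = (next (k := k) D M w).bind fun q =>
      scanItem D path b q.2 (scan k D M q.2) q.1 := by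
  rw [scan]
  rcases h : next (k := k) D M w with - | q
  · rfl
  · simp [length_next h]

/-- Read the formula. -/
noncomputable def mainLoop (M : Set MDLOp) : Prog k :=
  forEach .todo fun _ => stepProg M

/-- The recursion of `scan` becomes a loop driven by `todo`, which holds a symbol as long as a
formula is expected. The sum of the lengths of input and path never grows, since an operator on the
path was read from the input; so `B` bounds the path at every atom. -/
theorem run_mainLoop {D : MCTable} (M : Set MDLOp) (hn : 0 < D.n) {S : MCState k} (hS : Ready D S)
    (hi : S.idx = []) (hv : S.val = []) {B : ℕ} (hnB : D.n ≤ B) (hmB : D.m ≤ B)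
    (w : List MCSymbol) (path : List (Option Bool)) (f : Bool) (hB : w.length + path.length ≤ B) :
    Run (mainLoop M) { S with inp := w, path := path, todo := [()], ok := flag f }
      ((scan k D M w path f).map fun b =>
        { S with inp := [], path := [], todo := [], ok := flag b })
      ((w.length + 1) * (itemTime k B + 1) + 2) := by
  induction hN : w.length using Nat.strong_induction_on generalizing w path f with
  | _ N ih =>
    subst hN
    have h1 := run_stepProg (D := D) (S := { S with inp := w, path := path, todo := [], ok := flag f })
      M hn hS hi hv rfl (B := B) (by simp; omega) (by simp; omega) hnB hmB
    rw [scan_eq]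
    simp only at h1
    rcases h : next (k := k) D M w with - | ⟨i, r⟩
    · rw [h] at h1
      refine (Run.forEach_fail rfl h1).mono ?_
      nlinarith
    rw [h] at h1
    have hr : r.length < w.length := length_next h
    have ht : itemTime k B + ((r.length + 1) * (itemTime k B + 1) + 2) + 1 ≤
        (w.length + 1) * (itemTime k B + 1) + 2 := by
      have : (r.length + 1) * (itemTime k B + 1) ≤ w.length * (itemTime k B + 1) :=
        Nat.mul_le_mul_right _ hr
      have e : (w.length + 1) * (itemTime k B + 1) =
        w.length * (itemTime k B + 1) + (itemTime k B + 1) := by ring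
      omega
    cases i with
    | op c =>
      exact (Run.forEach_cons rfl h1 (ih _ hr r (c :: path) f (by simp; omega) rfl)).mono ht
    | leaf gs v =>
      simp only [Option.bind_some, itemResult, leafResult, unwindResult] at h1
      simp only [Option.bind_some, scanItem, resume]
      rcases hu : unwind path with - | p
      · rw [hu] at h1
        dsimp only at h1 ⊢
        split_ifs at h1 ⊢ with hr0
        · subst hr0
          refine (Run.forEach_cons rfl h1 (t' := 2) ?_).mono (le_trans ?_ ht)
          · exact (Run.forEach_nil (by rfl)).congr rfl
          · omega
        · exact (Run.forEach_fail rfl h1).mono (by omega)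
      · rw [hu] at h1
        have := length_unwind hu
        exact (Run.forEach_cons rfl h1 (ih _ hr r p _ (by omega) rfl)).mono ht

/-! ### Reading the structure and the team -/

/-- Read a bit. -/
def takeBit : List MCSymbol → Option (Bool × List MCSymbol)
  | .zero :: w => some (false, w)
  | .one :: w => some (true, w)
  | _ => none

/-- Read a vector, where each entry is read by `rd`. -/
def takeVec {α : Type} (rd : List MCSymbol → Option (α × List MCSymbol)) :
    (n : ℕ) → List MCSymbol → Option ((Fin n → α) × List MCSymbol)
  | 0, w => some (Fin.elim0, w)
  | n + 1, w => (rd w).bind fun q => (takeVec rd n q.2).map fun p => (Fin.cons q.1 p.1, p.2)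

/-- Handle a bit. -/
def bitStep (f : Bool → Prog k) : Option MCSymbol → Prog k
  | some .zero => f false
  | some .one => f true
  | _ => .fail

theorem run_bitStep (X : Stk) (enc : Bool → X.Alph k) (S : MCState k) :
    Run (.pop Stk.inp (bitStep fun b => .push X (enc b)) : Prog k) S
      ((takeBit S.inp).map fun q =>
        (S.set .inp q.2).set X (enc q.1 :: (S.set .inp q.2).get X)) 2 := by
  rcases h : S.inp with - | ⟨c, w⟩
  · exact ((Run.pop_nil h (Run.fail _)).congr rfl).mono (by omega)
  · refine Run.pop_cons (k := Stk.inp) (a := c) (l := w) (t := 1) h ?_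
    cases c with
    | zero => exact Run.push (Γ := Stk.Alph k) X (enc false) _
    | one => exact Run.push (Γ := Stk.Alph k) X (enc true) _
    | _ => exact Run.fail _

/-- The counter stack `c` fixes the number of entries to read, and `st` describes the state in terms
of the entries read so far, the input, and the unused and used parts of the counter. Entries pile up
in reverse, which is why `MCTable.worlds` is a reversed list. With a row reader as `rd` the same
rule reads matrices. -/
theorem run_forEach_takeVec {α : Type} {rd : List MCSymbol → Option (α × List MCSymbol)} {c : Stk}
    {body : c.Alph k → Prog k}
    {st : List α → List MCSymbol → List (c.Alph k) → List (c.Alph k) → MCState k}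
    (hget : ∀ as w l ls, (st as w l ls).get c = l) {t : ℕ}
    (hstep : ∀ as w a l ls, Run (body a) ((st as w (a :: l) ls).set c l)
      ((rd w).map fun q => st (q.1 :: as) q.2 l (a :: ls)) t)
    (l : List (c.Alph k)) (as : List α) (w : List MCSymbol) (ls : List (c.Alph k)) :
    Run (forEach c body) (st as w l ls) ((takeVec rd l.length w).map fun q =>
      st (((List.finRange l.length).map q.1).reverse ++ as) q.2 [] (l.reverse ++ ls))
      (l.length * (t + 1) + 2) := by
  induction l generalizing as w ls with
  | nil =>
    refine ((Run.forEach_nil (hget _ _ _ _)).congr ?_).mono (by omega)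
    refine congrArg some (StackStore.ext (Γ := Stk.Alph k) fun s => ?_)
    rcases eq_or_ne s c with rfl | hs
    · rw [get_set_self]
      exact (hget _ _ _ _).symm
    · rw [get_set_ne _ hs]
      simp
  | cons a l ih =>
    have h1 := hstep as w a l ls
    rw [List.length_cons, takeVec]
    rcases h : rd w with - | q
    · rw [h] at h1
      refine (Run.forEach_fail (hget _ _ _ _) h1).mono ?_
      nlinarith
    · rw [h] at h1
      refine ((Run.forEach_cons (hget _ _ _ _) h1 (ih (q.1 :: as) q.2 (a :: ls))).congr ?_).mono ?_
      · simp [Function.comp_def, List.finRange_succ]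
      · ring_nf
        omega

/-- Read the team. -/
def teamProg : Prog k :=
  (forEach .worlds fun u => .push .worlds2 u ;; .pop .inp (bitStep fun b => .push .team b)) ;;
    moveTo .worlds2 .worlds id

/-- Read a row of the accessibility matrix. -/
def relRowProg : Prog k :=
  (forEach .worlds fun u => .push .worlds2 u ;; .pop .inp (bitStep fun b => .push .rel (some b))) ;;
    moveTo .worlds2 .worlds id

/-- Read a row of the labelling matrix. -/
def labRowProg : Prog k :=
  (forEach .props fun u => .push .props2 u ;; .pop .inp (bitStep fun b => .push .lab (some b))) ;;
    moveTo .props2 .props id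

/-- Read the accessibility matrix. -/
def relProg : Prog k :=
  (forEach .team fun b => .push .team2 b ;; .push .rel none ;; relRowProg) ;;
    moveTo .team2 .team id

/-- Read the labelling matrix. -/
def labProg : Prog k :=
  (forEach .team fun b => .push .team2 b ;; labRowProg ;; .push .lab none) ;;
    moveTo .team2 .team id

theorem run_teamProg {n : ℕ} (S : MCState k) (h : S.worlds = List.replicate n ())
    (h2 : S.worlds2 = []) (hT : S.team = []) :
    Run teamProg S ((takeVec takeBit n S.inp).map fun q =>
      { S with inp := q.2, team := (List.finRange n).reverse.map q.1 }) (6 * n + 4) := by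
  have h1 := run_forEach_takeVec (k := k) (rd := takeBit) (c := .worlds)
    (body := fun u => .push .worlds2 u ;; .pop .inp (bitStep fun b => .push .team b)) (t := 3)
    (st := fun as w l ls => { S with inp := w, worlds := l, worlds2 := ls, team := as })
    (fun _ _ _ _ => rfl) (fun as w a l ls =>
      ((Run.push _ _ _).seq (run_bitStep .team (fun b => b) _)).congr rfl)
    (List.replicate n ()) [] S.inp []
  rw [List.length_replicate] at h1
  replace h1 := h1.congr' (S' := S) (by rw [← h, ← h2, ← hT])
  rcases hq : takeVec takeBit n S.inp with - | q
  · rw [hq] at h1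
    exact (Run.seq_fail h1).mono (by omega)
  · rw [hq] at h1
    refine ((h1.seq (run_move_worlds2 _)).congr ?_).mono ?_
    · simp [← h, h2]
    · simp
      omega

theorem run_relRowProg {n : ℕ} (S : MCState k) (h : S.worlds = List.replicate n ())
    (h2 : S.worlds2 = []) :
    Run relRowProg S ((takeVec takeBit n S.inp).map fun q =>
      { S with inp := q.2, rel := ((List.finRange n).reverse.map fun t => some (q.1 t)) ++ S.rel })
      (6 * n + 4) := by
  have h1 := run_forEach_takeVec (k := k) (rd := takeBit) (c := .worlds)
    (body := fun u => .push .worlds2 u ;; .pop .inp (bitStep fun b => .push .rel (some b))) (t := 3)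
    (st := fun as w l ls =>
      { S with inp := w, worlds := l, worlds2 := ls, rel := as.map some ++ S.rel })
    (fun _ _ _ _ => rfl) (fun as w a l ls =>
      ((Run.push _ _ _).seq (run_bitStep .rel (fun b => some b) _)).congr rfl)
    (List.replicate n ()) [] S.inp []
  rw [List.length_replicate] at h1
  replace h1 := h1.congr' (S' := S) (by rw [← h, ← h2]; rfl)
  rcases hq : takeVec takeBit n S.inp with - | q
  · rw [hq] at h1
    exact (Run.seq_fail h1).mono (by omega)
  · rw [hq] at h1
    refine ((h1.seq (run_move_worlds2 _)).congr ?_).mono ?_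
    · simp [← h, h2, Function.comp_def]
    · simp
      omega

theorem run_labRowProg {m : ℕ} (S : MCState k) (h : S.props = List.replicate m ())
    (h2 : S.props2 = []) :
    Run labRowProg S ((takeVec takeBit m S.inp).map fun q =>
      { S with inp := q.2, lab := ((List.finRange m).reverse.map fun t => some (q.1 t)) ++ S.lab })
      (6 * m + 4) := by
  have h1 := run_forEach_takeVec (k := k) (rd := takeBit) (c := .props)
    (body := fun u => .push .props2 u ;; .pop .inp (bitStep fun b => .push .lab (some b))) (t := 3)
    (st := fun as w l ls =>
      { S with inp := w, props := l, props2 := ls, lab := as.map some ++ S.lab })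
    (fun _ _ _ _ => rfl) (fun as w a l ls =>
      ((Run.push _ _ _).seq (run_bitStep .lab (fun b => some b) _)).congr rfl)
    (List.replicate m ()) [] S.inp []
  rw [List.length_replicate] at h1
  replace h1 := h1.congr' (S' := S) (by rw [← h, ← h2]; rfl)
  rcases hq : takeVec takeBit m S.inp with - | q
  · rw [hq] at h1
    exact (Run.seq_fail h1).mono (by omega)
  · rw [hq] at h1
    refine ((h1.seq (run_move_props2 _)).congr ?_).mono ?_
    · simp [← h, h2, Function.comp_def]
    · simp
      omega

/-- The inner loop occupies `worlds`, so `team` counts the rows. The separator is pushed before its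
row and therefore follows it when the stack is read from the top. -/
theorem run_relProg {n : ℕ} (S : MCState k) (h : S.worlds = List.replicate n ())
    (h2 : S.worlds2 = []) (hT : S.team.length = n) (hT2 : S.team2 = []) (hr : S.rel = []) :
    Run relProg S ((takeVec (takeVec takeBit n) n S.inp).map fun q =>
      { S with
        inp := q.2
        rel := encodeRows (List.finRange n).reverse (List.finRange n).reverse q.1 })
      (n * (6 * n + 7) + 2 * n + 4) := by
  have h1 := run_forEach_takeVec (k := k) (rd := takeVec takeBit n) (c := .team)
    (body := fun b => .push .team2 b ;; .push .rel none ;; relRowProg) (t := 6 * n + 6)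
    (st := fun as w l ls => { S with
      inp := w
      team := l
      team2 := ls
      rel := as.flatMap fun r => ((List.finRange n).reverse.map fun t => some (r t)) ++ [none] })
    (fun _ _ _ _ => rfl) (fun as w a l ls => by
      refine (((Run.push _ _ _).seq ((Run.push _ _ _).seq (run_relRowProg (n := n) _ ?_ ?_))).congr
        ?_).mono (by omega)
      · exact h
      · exact h2
      · simp)
    S.team [] S.inp []
  rw [hT] at h1
  replace h1 := h1.congr' (S' := S) (by rw [← hT2]; simp [← hr])
  rcases hq : takeVec (takeVec takeBit n) n S.inp with - | q
  · rw [hq] at h1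
    exact (Run.seq_fail h1).mono (by ring_nf; omega)
  · rw [hq] at h1
    refine ((h1.seq (run_move_team2 _)).congr ?_).mono ?_
    · simp [hT2, encodeRows, List.flatMap_map, ← List.map_reverse]
    · simp [hT]
      ring_nf
      omega

/-- In contrast to the accessibility matrix, the separator is pushed after the row, because `lab` is
stored in reverse and turned round by `colProg`. -/
theorem run_labProg {n m : ℕ} (S : MCState k) (h : S.props = List.replicate m ())
    (h2 : S.props2 = []) (hT : S.team.length = n) (hT2 : S.team2 = []) (hr : S.lab = []) :
    Run labProg S ((takeVec (takeVec takeBit m) n S.inp).map fun q =>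
      { S with
        inp := q.2
        lab := (encodeRows (List.finRange n) (List.finRange m) q.1).reverse })
      (n * (6 * m + 7) + 2 * n + 4) := by
  have h1 := run_forEach_takeVec (k := k) (rd := takeVec takeBit m) (c := .team)
    (body := fun b => .push .team2 b ;; labRowProg ;; .push .lab none) (t := 6 * m + 6)
    (st := fun as w l ls => { S with
      inp := w
      team := l
      team2 := ls
      lab := as.flatMap fun r => none :: ((List.finRange m).reverse.map fun t => some (r t)) })
    (fun _ _ _ _ => rfl) (fun as w a l ls => by
      have h3 := run_labRowProg (m := m) { S with
        inp := w
        team := l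
        team2 := a :: ls
        lab := as.flatMap fun r => none :: ((List.finRange m).reverse.map fun t => some (r t)) } h h2
      simp only at h3
      rcases hq : takeVec takeBit m w with - | q
      · rw [hq] at h3
        exact ((Run.push _ _ _).seq (Run.seq_fail h3)).mono (by omega)
      · rw [hq] at h3
        refine (((Run.push _ _ _).seq (h3.seq (Run.push _ _ _))).congr ?_).mono (by omega)
        simp)
    S.team [] S.inp []
  rw [hT] at h1
  replace h1 := h1.congr' (S' := S) (by rw [← hT2]; simp [← hr])
  rcases hq : takeVec (takeVec takeBit m) n S.inp with - | q
  · rw [hq] at h1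
    exact (Run.seq_fail h1).mono (by ring_nf; omega)
  · rw [hq] at h1
    refine ((h1.seq (run_move_team2 _)).congr ?_).mono ?_
    · simp [hT2, encodeRows, List.flatMap_map, ← List.map_reverse, List.reverse_flatMap,
        Function.comp_def]
    · simp [hT]
      ring_nf
      omega

theorem takeUnary_eq_some {w r : List MCSymbol} {n : ℕ} :
    takeUnary w = some (n, r) ↔ w = MCSymbol.unary n ++ r := by
  induction w generalizing n with
  | nil => simp [takeUnary, MCSymbol.unary]
  | cons c w ih =>
    cases n with
    | zero => cases c <;> simp [takeUnary, MCSymbol.unary]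
    | succ n =>
      have := @ih n
      cases c <;> simp_all [takeUnary, MCSymbol.unary, List.replicate_succ]

/-- The word of a bit. -/
def encodeBit (b : Bool) : List MCSymbol := [if b then .one else .zero]

theorem takeBit_eq_some {w r : List MCSymbol} {b : Bool} :
    takeBit w = some (b, r) ↔ w = encodeBit b ++ r := by
  unfold takeBit
  split <;> cases b <;> simp_all [encodeBit]

/-- An exact inverse of an encoding of entries yields one for vectors. Applied to bits and then to
rows it covers the matrices. -/
theorem takeVec_eq_some {α : Type} {rd : List MCSymbol → Option (α × List MCSymbol)}
    {enc : α → List MCSymbol} (h : ∀ {w r a}, rd w = some (a, r) ↔ w = enc a ++ r) {n : ℕ}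
    {w r : List MCSymbol} {x : Fin n → α} :
    takeVec rd n w = some (x, r) ↔ w = ((List.finRange n).flatMap fun i => enc (x i)) ++ r := by
  induction n generalizing w with
  | zero =>
    simp only [takeVec, List.finRange_zero, List.flatMap_nil, List.nil_append, Option.some.injEq,
      Prod.mk.injEq]
    exact and_iff_right (Subsingleton.elim _ _)
  | succ n ih =>
    simp only [takeVec, Option.bind_eq_some_iff, Option.map_eq_some_iff, List.finRange_succ,
      List.flatMap_cons, List.flatMap_map, List.append_assoc]
    constructor
    · rintro ⟨⟨a, w'⟩, h1, ⟨y, r'⟩, h2, h3⟩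
      obtain ⟨rfl, rfl⟩ := Prod.mk.inj h3
      dsimp only at h2 ⊢
      rw [h.1 h1, ih.1 h2]
      rfl
    · intro hw
      refine ⟨(x 0, _), h.2 hw, (fun i => x i.succ, r), ih.2 rfl, ?_⟩
      exact Prod.ext (Fin.cons_self_tail x) rfl

/-- Read a Kripke structure and a team. -/
def takeTable (w : List MCSymbol) : Option (MCTable × List MCSymbol) :=
  (takeUnary w).bind fun a => if 0 < a.1 then
    (takeUnary a.2).bind fun b => (takeVec takeBit a.1 b.2).bind fun c =>
      (takeVec (takeVec takeBit a.1) a.1 c.2).bind fun d =>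
        (takeVec (takeVec takeBit b.1) a.1 d.2).map fun e =>
          (⟨a.1, b.1, c.1, d.1, e.1⟩, e.2)
  else none

end ModelChecker

open ModelChecker in
/-- The word of a Kripke structure and a team. -/
def MCTable.encode (D : MCTable) : List MCSymbol :=
  MCSymbol.unary D.n ++ (MCSymbol.unary D.m ++
    (((List.finRange D.n).flatMap fun s => encodeBit (D.team s)) ++
    (((List.finRange D.n).flatMap fun s => (List.finRange D.n).flatMap fun t =>
      encodeBit (D.rel s t)) ++
    (List.finRange D.n).flatMap fun s => (List.finRange D.m).flatMap fun p =>
      encodeBit (D.lab s p))))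

namespace ModelChecker

variable {k : ℕ}

theorem takeTable_eq_some {w r : List MCSymbol} {D : MCTable} :
    takeTable w = some (D, r) ↔ 0 < D.n ∧ w = D.encode ++ r := by
  have hv : ∀ {n : ℕ} {w r : List MCSymbol} {x : Fin n → Bool}, takeVec takeBit n w = some (x, r) ↔
      w = ((List.finRange n).flatMap fun i => encodeBit (x i)) ++ r :=
    takeVec_eq_some takeBit_eq_some
  have hm : ∀ {n m : ℕ} {w r : List MCSymbol} {x : Fin n → Fin m → Bool},
      takeVec (takeVec takeBit m) n w = some (x, r) ↔
      w = ((List.finRange n).flatMap fun i => (List.finRange m).flatMap fun j =>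
        encodeBit (x i j)) ++ r :=
    takeVec_eq_some hv
  constructor
  · intro h
    obtain ⟨⟨n, w1⟩, h1, h⟩ := Option.bind_eq_some_iff.1 h
    split_ifs at h with hn
    obtain ⟨⟨m, w2⟩, h2, h⟩ := Option.bind_eq_some_iff.1 h
    obtain ⟨⟨T, w3⟩, h3, h⟩ := Option.bind_eq_some_iff.1 h
    obtain ⟨⟨R, w4⟩, h4, h⟩ := Option.bind_eq_some_iff.1 h
    obtain ⟨⟨V, w5⟩, h5, h⟩ := Option.map_eq_some_iff.1 h
    obtain ⟨rfl, rfl⟩ := Prod.mk.inj h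
    refine ⟨hn, ?_⟩
    dsimp only at h2 h3 h4 h5 ⊢
    rw [takeUnary_eq_some.1 h1, takeUnary_eq_some.1 h2, hv.1 h3, hm.1 h4, hm.1 h5]
    simp [MCTable.encode]
  · rintro ⟨hn, rfl⟩
    simp only [MCTable.encode, List.append_assoc]
    rw [takeTable, takeUnary_eq_some.2 rfl, Option.bind_some, if_pos hn, takeUnary_eq_some.2 rfl,
      Option.bind_some, hv.2 rfl, Option.bind_some, hm.2 rfl, Option.bind_some, hm.2 rfl]
    rfl

/-- The state after the table has been read. -/
def tableState (D : MCTable) (r : List MCSymbol) : MCState k where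
  inp := r
  worlds := List.replicate D.n ()
  props := List.replicate D.m ()
  team := D.worlds.map D.team
  rel := encodeRows D.worlds D.worlds D.rel
  lab := (encodeRows (List.finRange D.n) (List.finRange D.m) D.lab).reverse

/-- Read the table. -/
def tableProg : Prog k :=
  readUnary .worlds () ;; .pop .worlds (fun c => if c.isSome then .push .worlds () else .fail) ;;
    readUnary .props () ;; teamProg ;; relProg ;; labProg

theorem run_tableProg (w : List MCSymbol) : Run (tableProg : Prog k) ({ inp := w } : MCState k)
    ((takeTable w).map fun q => tableState q.1 q.2) (60 * (w.length + 1) ^ 2) := by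
  have hE : w.length + 1 ≤ (w.length + 1) ^ 2 := Nat.le_self_pow (by omega) _
  rw [takeTable]
  have h1 := run_readUnary (k := k) .worlds (by decide) () { inp := w }
  rcases h : takeUnary w with - | ⟨n, w1⟩
  · rw [show ({ inp := w } : MCState k).inp = w from rfl, h] at h1
    exact (Run.seq_fail h1).mono (by omega)
  rw [show ({ inp := w } : MCState k).inp = w from rfl, h] at h1
  have hl1 := length_takeUnary h
  by_cases hn : 0 < n
  swap
  · obtain rfl : n = 0 := by omega
    exact (h1.seq (Run.seq_fail (Run.pop_nil rfl (Run.fail _)))).mono (by omega)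
  obtain ⟨n, rfl⟩ : ∃ n', n = n' + 1 := ⟨n - 1, by omega⟩
  -- Popping one world and putting it back tests that the set of worlds is non-empty.
  have h2 : Run (.pop Stk.worlds (fun c => if c.isSome then .push .worlds () else .fail) : Prog k)
      ({ inp := w1, worlds := List.replicate (n + 1) () } : MCState k)
      (some { inp := w1, worlds := List.replicate (n + 1) () }) 2 :=
    Run.pop_cons rfl (Run.push (Γ := Stk.Alph k) .worlds () _)
  replace h1 := h1.congr
    (o' := some ({ inp := w1, worlds := List.replicate (n + 1) () } : MCState k)) (by simp)
  have h3 := run_readUnary (k := k) .props (by decide) ()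
    { inp := w1, worlds := List.replicate (n + 1) () }
  simp only [Option.bind_some, hn, if_true]
  rcases h : takeUnary w1 with - | ⟨m, w2⟩
  · simp only [h] at h3
    exact (h1.seq (h2.seq (Run.seq_fail h3))).mono (by omega)
  simp only [h] at h3
  have hl2 := length_takeUnary h
  replace h3 := h3.congr (o' := some ({
      inp := w2
      worlds := List.replicate (n + 1) ()
      props := List.replicate m () } : MCState k)) (by simp)
  have h4 := run_teamProg (k := k) (n := n + 1) {
      inp := w2
      worlds := List.replicate (n + 1) ()
      props := List.replicate m () } rfl rfl rfl
  have ht1 : (n + 1) * (6 * (n + 1) + 7) ≤ (w.length + 1) * (6 * (w.length + 1) + 7) := by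
    gcongr <;> omega
  have ht2 : (n + 1) * (6 * m + 7) ≤ (w.length + 1) * (6 * (w.length + 1) + 7) := by
    gcongr <;> omega
  have ht3 : (w.length + 1) * (6 * (w.length + 1) + 7) =
    6 * (w.length + 1) ^ 2 + 7 * (w.length + 1) := by ring
  simp only [Option.bind_some]
  rcases h : takeVec takeBit (n + 1) w2 with - | ⟨T, w3⟩
  · simp only [h] at h4
    exact (h1.seq (h2.seq (h3.seq (Run.seq_fail h4)))).mono (by omega)
  simp only [h] at h4
  have h5 := run_relProg (k := k) (n := n + 1) {
      inp := w3
      worlds := List.replicate (n + 1) ()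
      props := List.replicate m ()
      team := (List.finRange (n + 1)).reverse.map T } rfl rfl (by simp)
    rfl rfl
  simp only [Option.bind_some]
  rcases h : takeVec (takeVec takeBit (n + 1)) (n + 1) w3 with - | ⟨R, w4⟩
  · simp only [h] at h5
    exact (h1.seq (h2.seq (h3.seq (h4.seq (Run.seq_fail h5))))).mono (by omega)
  simp only [h] at h5
  have h6 := run_labProg (k := k) (n := n + 1) (m := m) {
      inp := w4
      worlds := List.replicate (n + 1) ()
      props := List.replicate m ()
      team := (List.finRange (n + 1)).reverse.map T
      rel := encodeRows (List.finRange (n + 1)).reverse (List.finRange (n + 1)).reverse R }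
    rfl rfl (by simp) rfl rfl
  simp only [Option.bind_some]
  refine ((h1.seq (h2.seq (h3.seq (h4.seq (h5.seq h6))))).congr ?_).mono (by omega)
  rw [Option.map_map]
  rfl

theorem ready_tableState (D : MCTable) (r : List MCSymbol) : Ready D (tableState (k := k) D r) :=
  ⟨⟨rfl, rfl, rfl, rfl, rfl⟩, rfl, rfl, rfl, rfl, rfl, rfl, rfl, rfl⟩

/-! ### The complete program and its running time -/

/-- The program for the model checking problem. -/
noncomputable def program (M : Set MDLOp) : Prog k :=
  tableProg ;; .push .todo () ;; mainLoop M ;; .pop .ok fun c => if c.isSome then .skip else .fail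

/-- The words accepted by `program`. -/
def Accepts (k : ℕ) (M : Set MDLOp) (w : List MCSymbol) : Prop :=
  ∃ D r, takeTable w = some (D, r) ∧ scan k D M r [] false = some true

theorem length_encode (D : MCTable) : D.n + D.m ≤ D.encode.length := by
  simp [MCTable.encode, MCSymbol.unary]
  omega

theorem run_program (M : Set MDLOp) (w : List MCSymbol) : ∃ o, Run (program M) ({ inp := w } : MCState k) o
    (60 * (w.length + 1) ^ 2 + (w.length + 1) * (itemTime k w.length + 1) + 5) ∧
    (o.isSome ↔ Accepts k M w) := by
  have h1 := run_tableProg (k := k) w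
  rcases h : takeTable w with - | ⟨D, r⟩
  · rw [h] at h1
    refine ⟨none, (Run.seq_fail h1).mono (by omega), ?_⟩
    simp [Accepts, h]
  rw [h] at h1
  obtain ⟨hn, hw⟩ := takeTable_eq_some.1 h
  have hl : D.encode.length + r.length = w.length := by rw [hw, List.length_append]
  have hl' := length_encode D
  have h2 := run_mainLoop (S := tableState (k := k) D r) M hn (ready_tableState D r) rfl rfl
    (B := w.length) (by omega) (by omega) r [] false (by simp; omega)
  have h3 : Run (.push .todo () : Prog k) (tableState D r)
      (some { tableState D r with inp := r, path := [], todo := [()], ok := flag false }) 1 :=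
    (Run.push _ _ _).congr rfl
  have ht : (r.length + 1) * (itemTime k w.length + 1) ≤
      (w.length + 1) * (itemTime k w.length + 1) := by
    gcongr
    omega
  have ha : Accepts k M w ↔ scan k D M r [] false = some true := by
    simp [Accepts, h]
  rw [ha]
  rcases hs : scan k D M r [] false with - | b
  · rw [hs] at h2
    exact ⟨none, (h1.seq (h3.seq (Run.seq_fail h2))).mono (by omega), by simp⟩
  rw [hs] at h2
  cases b
  · exact ⟨none, (h1.seq (h3.seq (h2.seq (Run.pop_nil rfl (Run.fail _))))).mono (by omega), by simp⟩
  · exact ⟨_, (h1.seq (h3.seq (h2.seq (Run.pop_cons rfl (Run.skip _))))).mono (by omega), by simp⟩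

theorem inP_of_accepts {M : Set MDLOp} {L : Language MCSymbol}
    (h : ∀ w, w ∈ L ↔ Accepts k M w) : InP L := by
  -- Every stack is cleared before the verdict is written, so any stack with alphabet `Bool` can
  -- carry it; `team` is such a stack.
  refine inP_of_run (St := MCState k) L (program M) Stk.inp Stk.team (Equiv.refl _) (Equiv.refl _)
    (fun w => { inp := w }) ?_
    (60 * (Polynomial.X + 1) ^ 2 + (Polynomial.X + 1) * (Polynomial.C
      ((k + 1) * 32 + ((depTests k).length + 1) * 16 + 20) * (Polynomial.X + 1) ^ 3 + 1) + 5) ?_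
  · intro w
    funext s
    cases s <;> simp
  · intro w
    obtain ⟨o, h1, h2⟩ := run_program (k := k) M w
    refine ⟨o, h1.mono (le_of_eq ?_), by rw [h2, h]⟩
    simp [itemTime]

end ModelChecker

/-! ### Team semantics of chains of modalities -/

namespace MCTable

variable (D : MCTable)

/-- The Kripke structure given by a table. -/
def kripke : KripkeStructure (Fin D.m) (Fin D.n) where
  R s t := D.rel s t = true
  label s := {p | D.lab s p = true}

/-- The team given by a table. -/
def teamSet : Set (Fin D.n) := {s | D.team s = true}

/-- The operation on properties of teams that belongs to a list of modalities, innermost first. -/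
def pathSat (D : MCTable) : List (Option Bool) → (Set (Fin D.n) → Prop) → Set (Fin D.n) → Prop
  | [], P => P
  | none :: p, P => D.pathSat p P
  | some true :: p, P => D.pathSat p fun T => P {s' | ∃ s ∈ T, D.kripke.R s s'}
  | some false :: p, P => D.pathSat p fun T => ∃ T', P T' ∧ ∀ s ∈ T, ∃ s' ∈ T', D.kripke.R s s'

/-- `AX` evaluates its argument at a team determined by the given one, and `EX` is an existential
quantifier over teams; an existential quantifier over `i` can be pulled out of either. -/
theorem pathSat_exists {ι : Type} (p : List (Option Bool)) (P : ι → Set (Fin D.n) → Prop) :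
    D.pathSat p (fun T => ∃ i, P i T) = fun T => ∃ i, D.pathSat p (P i) T := by
  induction p generalizing P with
  | nil => rfl
  | cons c p ih =>
    rcases c with - | - | -
    · exact ih P
    · refine Eq.trans ?_ (ih _)
      rw [pathSat]
      congr 1
      funext T
      exact propext ⟨fun ⟨T', ⟨i, h⟩, h'⟩ => ⟨i, T', h, h'⟩, fun ⟨i, T', h, h'⟩ => ⟨T', ⟨i, h⟩, h'⟩⟩
    · exact ih _

theorem pathSat_or (p : List (Option Bool)) (P Q : Set (Fin D.n) → Prop) :
    D.pathSat p (fun T => P T ∨ Q T) = fun T => D.pathSat p P T ∨ D.pathSat p Q T := by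
  have := D.pathSat_exists p fun b : Bool => if b then P else Q
  simpa [Bool.exists_bool, or_comm] using this

theorem modality_true (s : Fin D.n) (x : Fin D.n → Bool) :
    ModelChecker.modality true D.worlds (D.rel s) x = true ↔ ∀ t, D.rel s t = true → x t = true := by
  simp [ModelChecker.modality, worlds]

theorem modality_false (s : Fin D.n) (x : Fin D.n → Bool) :
    ModelChecker.modality false D.worlds (D.rel s) x = true ↔
      ∃ t, D.rel s t = true ∧ x t = true := by
  simp [ModelChecker.modality, worlds]

/-- Flatness survives each modality: all successors of `T` lie in `X` iff `T` lies in the box of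
`X`, and some successor team inside `X` exists iff `T` lies in the diamond of `X`. -/
theorem pathSat_forall (p : List (Option Bool)) (x : Fin D.n → Bool) :
    D.pathSat p (fun T => ∀ s ∈ T, x s = true) = fun T => ∀ s ∈ T, D.applyPath p x s = true := by
  induction p generalizing x with
  | nil => rfl
  | cons c p ih =>
    rcases c with - | - | -
    · exact ih x
    · rw [pathSat, applyPath, ← ih]
      congr 1
      funext T
      simp only [modality_false, eq_iff_iff]
      constructor
      · rintro ⟨T', h, h'⟩ s hs
        obtain ⟨t, ht, hst⟩ := h' s hs
        exact ⟨t, hst, h t ht⟩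
      -- The set itself is the largest candidate for the successor team. `EX` does not ask that
      -- every world of that team be a successor.
      · exact fun h => ⟨{t | x t = true}, fun _ h => h, fun s hs =>
          let ⟨t, hst, ht⟩ := h s hs
          ⟨t, ht, hst⟩⟩
    · rw [pathSat, applyPath, ← ih]
      congr 1
      funext T
      simp only [modality_true, eq_iff_iff]
      exact ⟨fun h s hs t hst => h t ⟨s, hs, hst⟩, fun h t ⟨s, hs, hst⟩ => h s hs t hst⟩

theorem check_eq_true (p : List (Option Bool)) (x : Fin D.n → Bool) :
    D.check p x = true ↔ D.pathSat p (fun T => ∀ s ∈ T, x s = true) D.teamSet := by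
  rw [pathSat_forall]
  simp [check, worlds, teamSet]

/-- The choice of an alternative is pulled out in front of the modalities by `pathSat_exists`; each
single alternative is flat and thus decided by `check`. -/
theorem any_check {α : Type} (gs : List (α → Bool)) (p : List (Option Bool)) (v : Fin D.n → α) :
    (gs.any fun g => D.check p fun s => g (v s)) = true ↔
      D.pathSat p (fun T => ∃ g ∈ gs, ∀ s ∈ T, g (v s) = true) D.teamSet := by
  have : (fun T => ∃ g ∈ gs, ∀ s ∈ T, g (v s) = true) =
      fun T : Set (Fin D.n) => ∃ g : {g // g ∈ gs}, ∀ s ∈ T, g.1 (v s) = true := by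
    funext T
    simp
  rw [this, pathSat_exists D p fun (g : {g // g ∈ gs}) T => ∀ s ∈ T, g.1 (v s) = true]
  simp [check_eq_true]

end MCTable

/-! ### Correctness of the scan -/

namespace ModelChecker

variable {k : ℕ}

open MCSymbol

theorem takeCol_eq_some {D : MCTable} {w r : List MCSymbol} {u v : Fin D.n → Bits k} :
    takeCol D w v = some (u, r) ↔ ∃ q : Fin D.m, w = unary q ++ r ∧
      u = fun s => consBits (D.lab s q) (v s) := by
  simp only [takeCol, Option.bind_eq_some_iff]
  constructor
  · rintro ⟨⟨q, r'⟩, h1, h2⟩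
    split_ifs at h2 with hq
    obtain ⟨rfl, rfl⟩ := Prod.mk.inj (Option.some_injective _ h2)
    exact ⟨⟨q, hq⟩, takeUnary_eq_some.1 h1, rfl⟩
  · rintro ⟨q, rfl, rfl⟩
    exact ⟨(q, r), takeUnary_eq_some.2 rfl, by simp⟩

theorem takeLast_eq_some {D : MCTable} {w r : List MCSymbol} {u v : Fin D.n → Bits k} :
    takeLast D w v = some (u, r) ↔ ∃ q : Fin D.m, w = encodeProp q ++ r ∧
      u = fun s => consBits (D.lab s q) (v s) := by
  rcases w with - | ⟨c, w⟩
  · simp [takeLast, encodeProp]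
  · cases c <;> simp [takeLast, takeCol_eq_some, encodeProp]

/-- Add columns of the labelling matrix to the data on the worlds. -/
def addCols (D : MCTable) (ps : List (Fin D.m)) (v : Fin D.n → Bits k) : Fin D.n → Bits k :=
  ps.foldl (fun v p s => consBits (D.lab s p) (v s)) v

theorem takeDep_eq_some {D : MCTable} {j : ℕ} {w r : List MCSymbol} {u v : Fin D.n → Bits k} :
    takeDep D j w v = some (u, r) ↔ ∃ (ps : List (Fin D.m)) (q : Fin D.m), ps.length ≤ j ∧
      w = (ps.flatMap encodeProp ++ semicolon :: encodeProp q) ++ r ∧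
      u = addCols D (ps ++ [q]) v := by
  constructor
  · intro h
    induction j generalizing w v with
    | zero =>
      unfold takeDep at h
      split at h
      · obtain ⟨q, rfl, rfl⟩ := takeLast_eq_some.1 h
        exact ⟨[], q, by simp, by simp, rfl⟩
      · omega
      · cases h
    | succ j ih =>
      rcases w with - | ⟨c, w⟩
      · simp [takeDep] at h
      · cases c <;> simp only [takeDep, reduceCtorEq] at h
        · obtain ⟨⟨v', r'⟩, h1, h2⟩ := Option.bind_eq_some_iff.1 h
          obtain ⟨p, rfl, rfl⟩ := takeCol_eq_some.1 h1
          obtain ⟨ps, q, hl, h3, rfl⟩ := ih h2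
          exact ⟨p :: ps, q, by simpa using hl, by simpa [encodeProp] using h3, rfl⟩
        · obtain ⟨q, rfl, rfl⟩ := takeLast_eq_some.1 h
          exact ⟨[], q, by simp, by simp, rfl⟩
  · rintro ⟨ps, q, hl, rfl, rfl⟩
    induction ps generalizing j v with
    | nil =>
      have := (takeLast_eq_some (k := k) (D := D) (v := v) (r := r)).2 ⟨q, rfl, rfl⟩
      cases j <;> simpa [takeDep, addCols] using this
    | cons p ps ih =>
      obtain ⟨j, rfl⟩ : ∃ j', j = j' + 1 := ⟨j - 1, by simp at hl; omega⟩
      simp only [List.flatMap_cons, encodeProp, List.cons_append, List.append_assoc]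
      rw [takeDep, takeCol_eq_some.2 ⟨p, rfl, rfl⟩, Option.bind_some]
      have := ih (j := j) (v := fun s => consBits (D.lab s p) (v s)) (by simpa using hl)
      simpa [encodeProp, addCols] using this

/-- The truncation in `consBits` keeps the alphabet finite but cuts off nothing as long as at most
`k + 1` bits are read. The last bit read comes first, so for a dependence atom the head belongs to
`q` and the tail to the arguments. -/
theorem val_addCols {D : MCTable} (ps : List (Fin D.m)) (v : Fin D.n → Bits k) (s : Fin D.n)
    (h : (v s).1.length + ps.length ≤ k + 1) :
    (addCols D ps v s).1 = (ps.map (D.lab s)).reverse ++ (v s).1 := by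
  induction ps generalizing v with
  | nil => simp [addCols]
  | cons p ps ih =>
    simp only [List.length_cons] at h
    have hc : (consBits (D.lab s p) (v s)).1 = D.lab s p :: (v s).1 := by
      simp only [consBits]
      exact List.take_of_length_le (by simp; omega)
    rw [addCols, List.foldl_cons]
    refine (ih (fun s => consBits (D.lab s p) (v s)) ?_).trans ?_
    · rw [hc]
      simp
      omega
    · rw [hc]
      simp

theorem sat_prop {D : MCTable} (q : Fin D.m) (T : Set (Fin D.n)) :
    D.kripke.Sat T (.prop q) ↔
      ∀ s ∈ T, headBit (consBits (k := k) (D.lab s q) nilBits) = true := by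
  simp [KripkeStructure.Sat, MCTable.kripke, headBit, consBits]

theorem sat_nprop {D : MCTable} (q : Fin D.m) (T : Set (Fin D.n)) :
    D.kripke.Sat T (.nprop q) ↔
      ∀ s ∈ T, (!headBit (consBits (k := k) (D.lab s q) nilBits)) = true := by
  simp [KripkeStructure.Sat, MCTable.kripke, headBit, consBits]

theorem label_inter_eq {D : MCTable} {s t : Fin D.n} {A : Set (Fin D.m)} :
    D.kripke.label s ∩ A = D.kripke.label t ∩ A ↔ ∀ p ∈ A, D.lab s p = D.lab t p := by
  constructor
  · intro h p hp
    have := Set.ext_iff.1 h p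
    exact Bool.eq_iff_iff.2 ⟨fun hs => (this.1 ⟨hs, hp⟩).1, fun ht => (this.2 ⟨ht, hp⟩).1⟩
  · intro h
    ext p
    refine and_congr_left fun hp => ?_
    change D.lab s p = true ↔ D.lab t p = true
    rw [h p hp]

/-- A dependence atom asserts that equal arguments give equal values, hence that some function
computes the value from the arguments on `T`. For each fixed function this is a condition on single
worlds. -/
theorem sat_dep {D : MCTable} {ps : List (Fin D.m)} (hps : ps.length ≤ k) (q : Fin D.m)
    (T : Set (Fin D.n)) :
    D.kripke.Sat T (.dep ps q) ↔ ∃ g ∈ depTests k, ∀ s ∈ T,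
      g (addCols D (ps ++ [q]) (fun _ => nilBits) s) = true := by
  have hv : ∀ s, (addCols D (ps ++ [q]) (fun _ => nilBits (k := k)) s).1 =
      D.lab s q :: (ps.map (D.lab s)).reverse := by
    intro s
    rw [val_addCols _ _ _ (by simp [nilBits]; omega)]
    simp [nilBits]
  have h1 : ∀ s, headBit (addCols D (ps ++ [q]) (fun _ => nilBits (k := k)) s) = D.lab s q := by
    intro s
    simp [headBit, hv]
  have h2 : ∀ s t, D.kripke.label s ∩ {p | p ∈ ps} = D.kripke.label t ∩ {p | p ∈ ps} ↔
      tailBits (addCols D (ps ++ [q]) (fun _ => nilBits (k := k)) s) =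
      tailBits (addCols D (ps ++ [q]) (fun _ => nilBits (k := k)) t) := by
    intro s t
    rw [label_inter_eq]
    simp only [tailBits, hv, List.tail_cons, Subtype.mk.injEq, List.reverse_inj,
      List.map_inj_left]
    rfl
  have h3 : ∀ s t, D.kripke.label s ∩ {q} = D.kripke.label t ∩ {q} ↔ D.lab s q = D.lab t q := by
    simp [label_inter_eq]
  simp only [KripkeStructure.Sat, depTests, List.mem_map, Finset.mem_toList, Set.Finite.mem_toFinset,
    Set.mem_univ, true_and, exists_exists_eq_and, beq_iff_eq, h1, h3, ne_eq, h2]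
  classical
  constructor
  · intro h
    -- The function is read off from the team: it is true at `b` iff some world of `T` with argument
    -- bits `b` satisfies `q`.
    refine ⟨fun b => decide (∃ s ∈ T, tailBits (addCols D (ps ++ [q]) (fun _ => nilBits) s) = b ∧
      D.lab s q = true), fun s hs => ?_⟩
    rw [Bool.eq_iff_iff, decide_eq_true_iff]
    refine ⟨fun h' => ⟨s, hs, rfl, h'⟩, ?_⟩
    rintro ⟨t, ht, h', hq⟩
    rcases h t ht s hs with h'' | h''
    · exact absurd h' h''
    · rw [← h'', hq]
  · rintro ⟨f, hf⟩ s hs t ht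
    rw [or_iff_not_imp_left, not_not]
    intro h
    rw [hf s hs, hf t ht, h]

theorem sat_ndep {D : MCTable} (ps : List (Fin D.m)) (q : Fin D.m) (T : Set (Fin D.n)) :
    D.kripke.Sat T (.ndep ps q) ↔ ∀ s ∈ T, (fun _ => false) s = true := by
  simp [KripkeStructure.Sat, Set.eq_empty_iff_forall_notMem]

theorem next_box {D : MCTable} {M : Set MDLOp} (h : MDLOp.box ∈ M) (w : List MCSymbol) :
    next (k := k) D M (box :: w) = some (.op (some true), w) :=
  if_pos h

theorem next_dia {D : MCTable} {M : Set MDLOp} (h : MDLOp.dia ∈ M) (w : List MCSymbol) :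
    next (k := k) D M (dia :: w) = some (.op (some false), w) :=
  if_pos h

theorem next_cor {D : MCTable} {M : Set MDLOp} (h : MDLOp.cor ∈ M) (w : List MCSymbol) :
    next (k := k) D M (cor :: w) = some (.op none, w) :=
  if_pos h

theorem next_prop {D : MCTable} {M : Set MDLOp} (q : Fin D.m) (w : List MCSymbol) :
    next (k := k) D M (encodeFormula (.prop q) ++ w) =
      some (.leaf [headBit] fun s => consBits (D.lab s q) nilBits, w) := by
  change Option.map _ (takeCol D (unary q ++ w) _) = _
  rw [takeCol_eq_some.2 ⟨q, rfl, rfl⟩]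
  rfl

theorem next_nprop {D : MCTable} {M : Set MDLOp} (h : MDLOp.neg ∈ M) (q : Fin D.m)
    (w : List MCSymbol) : next (k := k) D M (encodeFormula (.nprop q) ++ w) =
      some (.leaf [fun v => !headBit v] fun s => consBits (D.lab s q) nilBits, w) := by
  refine (if_pos h).trans ?_
  change Option.map _ (takeCol D (unary q ++ w) _) = _
  rw [takeCol_eq_some.2 ⟨q, rfl, rfl⟩]
  rfl

theorem next_dep {D : MCTable} {M : Set MDLOp} (h : MDLOp.dep ∈ M) {ps : List (Fin D.m)}
    (hps : ps.length ≤ k) (q : Fin D.m) (w : List MCSymbol) :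
    next (k := k) D M (encodeFormula (.dep ps q) ++ w) =
      some (.leaf (depTests k) (addCols D (ps ++ [q]) fun _ => nilBits), w) := by
  refine (if_pos h).trans ?_
  change Option.map _ (takeDep D k (_ ++ w) _) = _
  rw [takeDep_eq_some.2 ⟨ps, q, hps, rfl, rfl⟩]
  rfl

theorem next_ndep {D : MCTable} {M : Set MDLOp} (hn : MDLOp.neg ∈ M) (h : MDLOp.dep ∈ M)
    {ps : List (Fin D.m)} (hps : ps.length ≤ k) (q : Fin D.m) (w : List MCSymbol) :
    next (k := k) D M (encodeFormula (.ndep ps q) ++ w) =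
      some (.leaf [fun _ => false] (addCols D (ps ++ [q]) fun _ => nilBits), w) := by
  refine (if_pos hn).trans ((if_pos h).trans ?_)
  change Option.map _ (takeDep D k (_ ++ w) _) = _
  rw [takeDep_eq_some.2 ⟨ps, q, hps, rfl, rfl⟩]
  rfl

open Classical in
/-- Whether the team satisfies `φ` preceded by the modalities in `path`. -/
noncomputable def holds (D : MCTable) (path : List (Option Bool)) (φ : MDL (Fin D.m)) : Bool :=
  decide (D.pathSat path (fun T => D.kripke.Sat T φ) D.teamSet)

theorem holds_eq_true {D : MCTable} {path : List (Option Bool)} {φ : MDL (Fin D.m)} :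
    holds D path φ = true ↔ D.pathSat path (fun T => D.kripke.Sat T φ) D.teamSet := by
  simp [holds]

/-- The result of `scan` on a word that starts with the word of `φ`. -/
noncomputable def scanFormula (k : ℕ) (D : MCTable) (M : Set MDLOp) (φ : MDL (Fin D.m))
    (r : List MCSymbol) (path : List (Option Bool)) (b : Bool) : Option Bool :=
  resume path r (b || holds D path φ) fun p => scan k D M r p (b || holds D path φ)

theorem scan_leaf {D : MCTable} {M : Set MDLOp} {φ : MDL (Fin D.m)} {gs : List (Bits k → Bool)}
    {v : Fin D.n → Bits k} {w r : List MCSymbol} (h : next D M w = some (.leaf gs v, r))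
    (hφ : ∀ T, D.kripke.Sat T φ ↔ ∃ g ∈ gs, ∀ s ∈ T, g (v s) = true)
    (path : List (Option Bool)) (b : Bool) :
    scan k D M w path b = scanFormula k D M φ r path b := by
  have hd : (gs.any fun g => D.check path fun s => g (v s)) = holds D path φ := by
    rw [Bool.eq_iff_iff, MCTable.any_check, holds_eq_true]
    simp only [hφ]
  rw [scan_eq, h, Option.bind_some, scanItem, hd, scanFormula]

/-- The induction needs arbitrary `r`, `path` and `b`: a first disjunct is followed by the word of
the second one, and the second is read with a flag that already accounts for the first. The
hypothesis `hM` excludes `⊤`, `⊥`, `∧` and `∨`. -/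
theorem scan_encodeFormula {D : MCTable} {M : Set MDLOp}
    (hM : M ⊆ {MDLOp.box, MDLOp.dia, MDLOp.cor, MDLOp.neg, MDLOp.dep}) (φ : MDL (Fin D.m))
    (hφ : φ ∈ MDL.fragment (Fin D.m) k M) (r : List MCSymbol) (path : List (Option Bool))
    (b : Bool) :
    scan k D M (encodeFormula φ ++ r) path b = scanFormula k D M φ r path b := by
  obtain ⟨ho, ha⟩ := hφ
  induction φ generalizing r path b with
  | top => simpa using hM (ho rfl)
  | bot => simpa using hM (ho rfl)
  | or φ ψ => simpa using hM (ho (.inl (.inl rfl)))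
  | and φ ψ => simpa using hM (ho (.inl (.inl rfl)))
  | prop q => exact scan_leaf (next_prop q r) (fun T => by simp [sat_prop (k := k)]) path b
  | nprop q =>
    exact scan_leaf (next_nprop (ho rfl) q r) (fun T => by simp [sat_nprop (k := k)]) path b
  | dep ps q => exact scan_leaf (next_dep (ho rfl) ha q r) (fun T => sat_dep ha q T) path b
  | ndep ps q =>
    exact scan_leaf (next_ndep (ho (.inl rfl)) (ho (.inr rfl)) ha q r)
      (fun T => by rw [sat_ndep]; simp) path b
  | box φ ih =>
    rw [scan_eq, encodeFormula, List.cons_append, next_box (ho (.inl rfl)), Option.bind_some]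
    -- `unwind` drops the modality and `pathSat` absorbs it into the path, so both sides agree by
    -- definition.
    exact ih r (some true :: path) b (fun o h => ho (.inr h)) ha
  | dia φ ih =>
    rw [scan_eq, encodeFormula, List.cons_append, next_dia (ho (.inl rfl)), Option.bind_some]
    exact ih r (some false :: path) b (fun o h => ho (.inr h)) ha
  | cor φ ψ ihφ ihψ =>
    rw [scan_eq, encodeFormula, List.cons_append, next_cor (ho (.inl (.inl rfl))),
      Option.bind_some, List.append_assoc]
    -- The marker `none` has no effect on `holds`, and `unwind` stops at it; so the scan resumes
    -- with `ψ` under the same `path`.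
    refine (ihφ (encodeFormula ψ ++ r) (none :: path) b (fun o h => ho (.inl (.inr h))) ha.1).trans
      ((ihψ r path _ (fun o h => ho (.inr h)) ha.2).trans ?_)
    have : holds D path (.cor φ ψ) = (holds D path φ || holds D path ψ) := by
      rw [Bool.eq_iff_iff, Bool.or_eq_true, holds_eq_true, holds_eq_true, holds_eq_true]
      simp only [KripkeStructure.Sat, MCTable.pathSat_or]
    rw [scanFormula.eq_1 k D M (.cor φ ψ), this, ← Bool.or_assoc]
    rfl

theorem nextNeg_eq_leaf {D : MCTable} {M : Set MDLOp} (hn : MDLOp.neg ∈ M) {w r : List MCSymbol}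
    {i : Item D k} (h : nextNeg D M w = some (i, r)) :
    ∃ φ ∈ MDL.fragment (Fin D.m) k M, neg :: w = encodeFormula φ ++ r ∧ ∃ gs v, i = .leaf gs v := by
  unfold nextNeg at h
  split at h
  · obtain ⟨⟨v, r'⟩, h1, h2⟩ := Option.map_eq_some_iff.1 h
    obtain ⟨rfl, rfl⟩ := Prod.mk.inj h2
    obtain ⟨q, rfl, -⟩ := takeCol_eq_some.1 h1
    exact ⟨.nprop q, ⟨by simpa [MDL.ops] using hn, trivial⟩, rfl, _, _, rfl⟩
  · split_ifs at h with hM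
    obtain ⟨⟨v, r'⟩, h1, h2⟩ := Option.map_eq_some_iff.1 h
    obtain ⟨rfl, rfl⟩ := Prod.mk.inj h2
    obtain ⟨ps, q, hps, rfl, -⟩ := takeDep_eq_some.1 h1
    exact ⟨.ndep ps q, ⟨by simpa [MDL.ops, Set.insert_subset_iff] using ⟨hn, hM⟩, hps⟩, rfl, _, _, rfl⟩
  · cases h

/-- The symbol of an operator. -/
def opSymbol : Option Bool → MCSymbol
  | some true => box
  | some false => dia
  | none => cor

/-- The name of an operator. -/
def opName : Option Bool → MDLOp
  | some true => .box
  | some false => .dia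
  | none => .cor

theorem next_eq_some {D : MCTable} {M : Set MDLOp} {w r : List MCSymbol} {i : Item D k}
    (h : next D M w = some (i, r)) :
    (∃ φ ∈ MDL.fragment (Fin D.m) k M, w = encodeFormula φ ++ r ∧ ∃ gs v, i = .leaf gs v) ∨
      ∃ c, i = .op c ∧ w = opSymbol c :: r ∧ opName c ∈ M := by
  unfold next at h
  split at h
  · split_ifs at h with hM
    obtain ⟨rfl, rfl⟩ := Prod.mk.inj (Option.some_injective _ h)
    exact .inr ⟨_, rfl, rfl, hM⟩
  · split_ifs at h with hM
    obtain ⟨rfl, rfl⟩ := Prod.mk.inj (Option.some_injective _ h)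
    exact .inr ⟨_, rfl, rfl, hM⟩
  · split_ifs at h with hM
    obtain ⟨rfl, rfl⟩ := Prod.mk.inj (Option.some_injective _ h)
    exact .inr ⟨_, rfl, rfl, hM⟩
  · obtain ⟨⟨v, r'⟩, h1, h2⟩ := Option.map_eq_some_iff.1 h
    obtain ⟨rfl, rfl⟩ := Prod.mk.inj h2
    obtain ⟨q, rfl, -⟩ := takeCol_eq_some.1 h1
    exact .inl ⟨.prop q, ⟨by simp [MDL.ops], trivial⟩, rfl, _, _, rfl⟩
  · split_ifs at h with hM
    exact .inl (nextNeg_eq_leaf hM h)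
  · split_ifs at h with hM
    obtain ⟨⟨v, r'⟩, h1, h2⟩ := Option.map_eq_some_iff.1 h
    obtain ⟨rfl, rfl⟩ := Prod.mk.inj h2
    obtain ⟨ps, q, hps, rfl, -⟩ := takeDep_eq_some.1 h1
    exact .inl ⟨.dep ps q, ⟨by simpa [MDL.ops] using hM, hps⟩, rfl, _, _, rfl⟩
  · cases h

/-- This excludes malformed words. An operator is followed by a shorter word that is scanned
successfully, so it starts with a formula by induction. -/
theorem exists_formula_of_scan {D : MCTable} {M : Set MDLOp}
    (hM : M ⊆ {MDLOp.box, MDLOp.dia, MDLOp.cor, MDLOp.neg, MDLOp.dep}) (w : List MCSymbol)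
    (path : List (Option Bool)) (b c : Bool) (h : scan k D M w path b = some c) :
    ∃ φ ∈ MDL.fragment (Fin D.m) k M, ∃ r, w = encodeFormula φ ++ r := by
  induction hN : w.length using Nat.strong_induction_on generalizing w path b c with
  | _ N ih =>
    subst hN
    rw [scan_eq] at h
    obtain ⟨⟨i, r⟩, h1, h2⟩ := Option.bind_eq_some_iff.1 h
    rcases next_eq_some h1 with ⟨φ, hφ, hw, -⟩ | ⟨o, rfl, hw, ho⟩
    · exact ⟨φ, hφ, r, hw⟩
    have hr := length_next h1
    obtain ⟨φ, hφ, r', rfl⟩ := ih _ hr r (o :: path) b c h2 rfl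
    rcases o with - | - | -
    · change scan k D M (encodeFormula φ ++ r') (none :: path) b = some c at h2
      -- Correctness on the first disjunct shows that the scan goes on successfully at `r'`, where
      -- induction yields the second disjunct.
      rw [scan_encodeFormula hM φ hφ] at h2
      obtain ⟨ψ, hψ, r, rfl⟩ := ih r'.length (by simp at hr; omega) r' path _ c h2 rfl
      refine ⟨.cor φ ψ, ⟨?_, hφ.2, hψ.2⟩, r, by rw [hw, encodeFormula]; simp [opSymbol]⟩
      exact Set.union_subset (Set.union_subset (Set.singleton_subset_iff.2 ho) hφ.1) hψ.1
    · refine ⟨.dia φ, ⟨?_, hφ.2⟩, r', hw⟩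
      exact Set.union_subset (Set.singleton_subset_iff.2 ho) hφ.1
    · refine ⟨.box φ, ⟨?_, hφ.2⟩, r', hw⟩
      exact Set.union_subset (Set.singleton_subset_iff.2 ho) hφ.1

theorem scan_eq_some_true {D : MCTable} {M : Set MDLOp}
    (hM : M ⊆ {MDLOp.box, MDLOp.dia, MDLOp.cor, MDLOp.neg, MDLOp.dep}) (w : List MCSymbol) :
    scan k D M w [] false = some true ↔ ∃ φ ∈ MDL.fragment (Fin D.m) k M,
      D.kripke.Sat D.teamSet φ ∧ w = encodeFormula φ := by
  constructor
  · intro h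
    obtain ⟨φ, hφ, r, rfl⟩ := exists_formula_of_scan hM w _ _ _ h
    rw [scan_encodeFormula hM φ hφ] at h
    simp only [scanFormula, resume, unwind] at h
    split_ifs at h with hr
    refine ⟨φ, hφ, ?_, by simp [hr]⟩
    have h' := Option.some_injective _ h
    rw [Bool.false_or] at h'
    exact holds_eq_true.1 h'
  · rintro ⟨φ, hφ, h, rfl⟩
    have := scan_encodeFormula hM φ hφ [] [] false
    rw [List.append_nil] at this
    rw [this]
    simp [scanFormula, resume, unwind, holds_eq_true, MCTable.pathSat, h]

end ModelChecker

/-! ### Instances as Boolean tables, and the conclusion -/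

open Classical in
/-- The table of an instance of the model checking problem. -/
noncomputable def MCInstance.table (I : MCInstance) : MCTable where
  n := I.numWorlds
  m := I.numProps
  team s := decide (s ∈ I.T)
  rel s t := decide (I.W.R s t)
  lab s p := decide (p ∈ I.W.label s)

theorem MCInstance.kripke_table (I : MCInstance) : I.table.kripke = I.W := by
  rcases I with ⟨n, m, hn, ⟨R, V⟩, T, φ⟩
  simp [MCTable.kripke, MCInstance.table]

theorem MCInstance.teamSet_table (I : MCInstance) : I.table.teamSet = I.T := by
  simp [MCTable.teamSet, MCInstance.table]

theorem ModelChecker.encodeBit_decide (p : Prop) [Decidable p] :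
    encodeBit (decide p) = [MCSymbol.bit p] := by
  by_cases h : p <;> simp [h, encodeBit, MCSymbol.bit]

theorem MCInstance.encode_eq (I : MCInstance) :
    I.encode = I.table.encode ++ MCSymbol.encodeFormula I.φ := by
  simp only [MCInstance.encode, MCTable.encode, MCInstance.table, ModelChecker.encodeBit_decide,
    List.map_eq_flatMap, List.append_assoc]

/-- The instance of the model checking problem given by a table and a formula. -/
def MCTable.toInstance (D : MCTable) (hn : 0 < D.n) (φ : MDL (Fin D.m)) : MCInstance where
  numWorlds := D.n
  numProps := D.m
  numWorlds_pos := hn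
  W := D.kripke
  T := D.teamSet
  φ := φ

/-- The classical decision of `b = true` gives back `b`, so turning a table into relations and back
loses nothing. -/
theorem MCTable.table_toInstance (D : MCTable) (hn : 0 < D.n) (φ : MDL (Fin D.m)) :
    (D.toInstance hn φ).table = D := by
  change MCTable.mk D.n D.m (fun s => @decide (D.team s = true) (Classical.propDecidable _))
    (fun s t => @decide (D.rel s t = true) (Classical.propDecidable _))
    (fun s p => @decide (D.lab s p = true) (Classical.propDecidable _)) = D
  simp only [Bool.decide_eq_true]

namespace ModelChecker

theorem mem_modelChecking_iff_accepts (k : ℕ) {M : Set MDLOp}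
    (hM : M ⊆ {MDLOp.box, MDLOp.dia, MDLOp.cor, MDLOp.neg, MDLOp.dep}) (w : List MCSymbol) :
    w ∈ modelChecking k M ↔ Accepts k M w := by
  constructor
  · rintro ⟨I, hφ, hI, rfl⟩
    refine ⟨I.table, _, takeTable_eq_some.2 ⟨I.numWorlds_pos, I.encode_eq⟩,
      (scan_eq_some_true hM _).2 ⟨I.φ, hφ, ?_, rfl⟩⟩
    rw [← I.kripke_table, ← I.teamSet_table] at hI
    exact hI
  · rintro ⟨D, r, h, hs⟩
    obtain ⟨hn, rfl⟩ := takeTable_eq_some.1 h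
    obtain ⟨φ, hφ, hI, rfl⟩ := (scan_eq_some_true hM _).1 hs
    refine ⟨D.toInstance hn φ, hφ, hI, ?_⟩
    rw [MCInstance.encode_eq, MCTable.table_toInstance]
    rfl

end ModelChecker

theorem theorem5p3 (M : Set MDLOp)
    (hM : M ⊆ {MDLOp.box, MDLOp.dia, MDLOp.cor, MDLOp.neg, MDLOp.dep}) (k : ℕ) :
    InP (modelChecking k M) :=
  ModelChecker.inP_of_accepts (ModelChecker.mem_modelChecking_iff_accepts k hM)
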